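/- Let $d\in\{2,3\}$, let $\Omega\subset\mathbb R^d$ be a bounded polygonal (polyhedral) domain, and let $\mathcal T_h$ be a conforming triangulation of $\Omega$ into simplices $K$ with edges (faces) $\mathcal E_h$, mesh size $h$, and shape regularity constant $\sigma$ (every $K$ contains a ball whose diameter $\rho_K$ satisfies $h_K\le\sigma\rho_K$, where $h_K$, $h_e$ are the diameters of $K$, $e$). Fix $l\ge1$ and $\eta>0$ and set $$\boldsymbol U_h=\{\boldsymbol u\in H(\mathrm{div};\Omega):\boldsymbol u|_K\in\boldsymbol U(K)\ \forall K,\ \boldsymbol u\cdot\boldsymbol n=0\text{ on }\partial\Omega\},$$ $$\boldsymbol V_{i,h}=\{\boldsymbol v\in H(\mathrm{div};\Omega):\boldsymbol v|_K\in RT_{l-1}(K)\ \forall K,\ \boldsymbol v\cdot\boldsymbol n=0\text{ on }\partial\Omega\},\qquad P_{i,h}=\{q\in L^2(\Omega):q|_K\in P_{l-1}(K)\ \forall K,\ \textstyle\int_\Omega q=0\},$$ where either $\boldsymbol U(K)=BDM_l(K)$ for all $K$ or $\boldsymbol U(K)=BDFM_l(K)$ for all $K$; $\boldsymbol V_h=\prod_{i=1}^n\boldsymbol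 V_{i,h}$, $\boldsymbol P_h=\prod_{i=1}^nP_{i,h}$. Let $n\ge1$, $\lambda,\tau,\alpha_i,K_i>0$, $c_{p_i}\ge0$, $\beta_{ij}=\beta_{ji}\ge0$ ($i\ne j$), $\beta_{ii}=\sum_{j\ne i}\beta_{ij}$, and put $R_i^{-1}=\tau^{-1}K_i^{-1}\alpha_i^2$, $\alpha_{p_i}=c_{p_i}/\alpha_i^2$, $\alpha_{ij}=\tau\beta_{ij}/(\alpha_i\alpha_j)$, $\tilde\alpha_{ii}=-\alpha_{p_i}-\alpha_{ii}$, $R^{-1}=\max_iR_i^{-1}$, $\lambda_0=\max\{1,\lambda\}$. Let $\Lambda=\Lambda_1+\Lambda_2+\Lambda_3+\Lambda_4$ be the $n\times n$ matrix for which $\Lambda_1$ has diagonal entries $\alpha_{ii}$ and off-diagonal entries $-\alpha_{ij}$, $\Lambda_2=\mathrm{diag}(\alpha_{p_i})$, $\Lambda_3=R\,I$ with $R=(R^{-1})^{-1}$, and all entries of $\Lambda_4$ are $1/\lambda_0$. On an interior $e=\partial K_1\cap\partial K_2$ with exterior unit normals $\boldsymbol n_1$, $\boldsymbol n_2$ let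 $\{\boldsymbol\tau\}=\frac12(\boldsymbol\tau|_{K_1}\boldsymbol n_1-\boldsymbol\tau|_{K_2}\boldsymbol n_2)$ and $[\boldsymbol u]=\boldsymbol u|_{K_1}-\boldsymbol u|_{K_2}$; on a boundary $e$ let $\{\boldsymbol\tau\}=\boldsymbol\tau\boldsymbol n$ and $[\boldsymbol u]=\boldsymbol u$; and let $\boldsymbol u_t=\boldsymbol u-(\boldsymbol u\cdot\boldsymbol n)\boldsymbol n$. With $(\cdot,\cdot)$ and $\|\cdot\|$ the $L^2(\Omega)$ inner product and norm, define $$a_h(\boldsymbol u,\boldsymbol w)=\sum_K\int_K\boldsymbol\epsilon(\boldsymbol u):\boldsymbol\epsilon(\boldsymbol w)-\sum_e\int_e\{\boldsymbol\epsilon(\boldsymbol u)\}\cdot[\boldsymbol w_t]-\sum_e\int_e\{\boldsymbol\epsilon(\boldsymbol w)\}\cdot[\boldsymbol u_t]+\sum_e\int_e\eta h_e^{-1}[\boldsymbol u_t]\cdot[\boldsymbol w_t],$$ $$\begin{aligned}\mathcal A_h((\boldsymbol u;\boldsymbol v;\boldsymbol p),(\boldsymbol w;\boldsymbol z;\boldsymbol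 q))={}&a_h(\boldsymbol u,\boldsymbol w)+\lambda(\mathrm{div}\,\boldsymbol u,\mathrm{div}\,\boldsymbol w)-\sum_i(p_i,\mathrm{div}\,\boldsymbol w)+\sum_i(R_i^{-1}\boldsymbol v_i,\boldsymbol z_i)-\sum_i(p_i,\mathrm{div}\,\boldsymbol z_i)\\&-\sum_i(\mathrm{div}\,\boldsymbol u,q_i)-\sum_i(\mathrm{div}\,\boldsymbol v_i,q_i)+\sum_i\tilde\alpha_{ii}(p_i,q_i)+\sum_i\sum_{j\ne i}\alpha_{ij}(p_j,q_i),\end{aligned}$$ $$\|\boldsymbol u\|_{\boldsymbol U_h}^2=\sum_K\|\nabla\boldsymbol u\|_{0,K}^2+\sum_eh_e^{-1}\|[\boldsymbol u_t]\|_{0,e}^2+\sum_Kh_K^2|\boldsymbol u|_{2,K}^2+\lambda\|\mathrm{div}\,\boldsymbol u\|^2,$$ $$\|\boldsymbol v\|_{\boldsymbol V}^2=\sum_i(R_i^{-1}\boldsymbol v_i,\boldsymbol v_i)+(\Lambda^{-1}\mathrm{Div}\,\boldsymbol v,\mathrm{Div}\,\boldsymbol v),\qquad\|\boldsymbol p\|_{\boldsymbol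 P}^2=(\Lambda\boldsymbol p,\boldsymbol p),\qquad \mathrm{Div}\,\boldsymbol v=(\mathrm{div}\,\boldsymbol v_1,\dots,\mathrm{div}\,\boldsymbol v_n)^T.$$ Then there is a constant $C_{bd}>0$, depending at most on $d$, $\Omega$, $l$, the choice of $BDM$ or $BDFM$, $\sigma$ and $\eta$ (so not on $\lambda$, $R_i^{-1}$, $\alpha_{p_i}$, $\alpha_{ij}$, the number of networks $n$, the triangulation and its mesh size $h$), such that for all $(\boldsymbol u_h;\boldsymbol v_h;\boldsymbol p_h),(\boldsymbol w_h;\boldsymbol z_h;\boldsymbol q_h)\in\boldsymbol U_h\times\boldsymbol V_h\times\boldsymbol P_h$ $$|\mathcal A_h((\boldsymbol u_h;\boldsymbol v_h;\boldsymbol p_h),(\boldsymbol w_h;\boldsymbol z_h;\boldsymbol q_h))|\le C_{bd}\,(\|\boldsymbol u_h\|_{\boldsymbol U_h}+\|\boldsymbol v_h\|_{\boldsymbol V}+\|\boldsymbol p_h\|_{\boldsymbol P})(\|\boldsymbol w_h\|_{\boldsymbol U_h}+\|\boldsymbol z_h\|_{\boldsymbol V}+\|\boldsymbol q_h\|_{\boldsymbol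 P}).$$ -/

import Mathlib

open MeasureTheory Matrix

open scoped ContDiff

noncomputable section

namespace MPET

/-- Points and vectors of `ℝ^d` with the Euclidean norm. -/
abbrev Pt (d : ℕ) := EuclideanSpace ℝ (Fin d)

/-- The scaled parameters of the `n`-network model (those obtained after division by `2μ`): the Lamé
parameter, the time step, the Biot-Willis coefficients, the hydraulic conductivities, the storage
coefficients and the network transfer coefficients (only the off-diagonal `beta i j` matter). -/
structure Params (n : ℕ) where
  lam : ℝ
  tau : ℝ
  alpha : Fin n → ℝ
  K : Fin n → ℝ
  c : Fin n → ℝ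
  beta : Fin n → Fin n → ℝ
  lam_pos : 0 < lam
  tau_pos : 0 < tau
  alpha_pos : ∀ i, 0 < alpha i
  K_pos : ∀ i, 0 < K i
  c_nonneg : ∀ i, 0 ≤ c i
  beta_nonneg : ∀ i j, 0 ≤ beta i j
  beta_symm : ∀ i j, beta i j = beta j i

namespace Params

variable {n : ℕ} (M : Params n)

/-- `R_i⁻¹ = τ⁻¹ K_i⁻¹ α_i²`. -/
def Rinv (i : Fin n) : ℝ := M.tau⁻¹ * (M.K i)⁻¹ * M.alpha i ^ 2

/-- `α_{p_i} = c_{p_i} / α_i²`. -/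
def alphaP (i : Fin n) : ℝ := M.c i / M.alpha i ^ 2

/-- The transfer coefficients with the diagonal `β_ii = ∑_{j ≠ i} β_ij`. -/
def betaFull (i j : Fin n) : ℝ :=
  if i = j then ∑ k ∈ Finset.univ.erase i, M.beta i k else M.beta i j

/-- `α_ij = τ β_ij / (α_i α_j)`. -/
def alphaNet (i j : Fin n) : ℝ := M.tau * M.betaFull i j / (M.alpha i * M.alpha j)

/-- `R⁻¹ = max {R_1⁻¹, …, R_n⁻¹}`. -/
def RinvMax [NeZero n] : ℝ := Finset.univ.sup' Finset.univ_nonempty M.Rinv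

/-- `λ₀ = max {1, λ}`. -/
def lam0 : ℝ := max 1 M.lam

def Lambda1 : Matrix (Fin n) (Fin n) ℝ :=
  Matrix.of fun i j => if i = j then M.alphaNet i i else -M.alphaNet i j

def Lambda2 : Matrix (Fin n) (Fin n) ℝ := Matrix.diagonal M.alphaP

def Lambda3 [NeZero n] : Matrix (Fin n) (Fin n) ℝ := Matrix.diagonal fun _ => (M.RinvMax)⁻¹

def Lambda4 : Matrix (Fin n) (Fin n) ℝ := Matrix.of fun _ _ => 1 / M.lam0

/-- `Λ = Λ₁ + Λ₂ + Λ₃ + Λ₄`. -/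
def Lambda [NeZero n] : Matrix (Fin n) (Fin n) ℝ :=
  M.Lambda1 + M.Lambda2 + M.Lambda3 + M.Lambda4

end Params

variable {d : ℕ}

/-! ### Weak divergence and `H(div; Ω)` -/

/-- `g` is the distributional divergence of the vector field `f` on `Ω`:
`∫_Ω f · ∇φ = - ∫_Ω g φ` for all test functions `φ`. -/
def IsWeakDiv (Ω : Set (Pt d)) (f : Pt d → Pt d) (g : Pt d → ℝ) : Prop :=
  ∀ φ : Pt d → ℝ, ContDiff ℝ ∞ φ → HasCompactSupport φ → tsupport φ ⊆ Ω →
    ∫ x in Ω, fderiv ℝ φ x (f x) = - ∫ x in Ω, g x * φ x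

/-- `f` belongs to `L²(Ω)^d` and has a distributional divergence in `L²(Ω)`. -/
def MemHDiv (Ω : Set (Pt d)) (f : Pt d → Pt d) : Prop :=
  MemLp f 2 (volume.restrict Ω) ∧ ∃ g : Pt d → ℝ, MemLp g 2 (volume.restrict Ω) ∧ IsWeakDiv Ω f g

open scoped Classical in
/-- The divergence of a field in `H(div; Ω)` (unique up to null sets; zero outside `H(div; Ω)`). -/
def weakDiv (Ω : Set (Pt d)) (f : Pt d → Pt d) : Pt d → ℝ :=
  if h : MemHDiv Ω f then h.2.choose else 0

/-! ### Simplices and triangulations -/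

/-- The closed simplex with the given vertices. -/
def hull (s : Finset (Pt d)) : Set (Pt d) := convexHull ℝ (s : Set (Pt d))

/-- The unit normal of the face `e` of the simplex `K`, exterior to `K`: the normalized component,
orthogonal to `e`, of the vector from the centroid of `K` to the centroid of `e`. -/
def normal (K e : Finset (Pt d)) : Pt d :=
  NormedSpace.normalize
    ((vectorSpan ℝ (e : Set (Pt d)))ᗮ.starProjection
      (e.centroid ℝ id - K.centroid ℝ id))

/-- The elements of the set `elems` of simplices that have the edge (or face) `e`. -/
def adjacent (elems : Finset (Finset (Pt d))) (e : Finset (Pt d)) : Set (Finset (Pt d)) :=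
  {K | K ∈ elems ∧ e ⊆ K}

open scoped Classical in
/-- All edges (or faces) of a set of `d`-simplices: the `d`-point subsets of the vertex sets. -/
def facesOf (elems : Finset (Finset (Pt d))) : Finset (Finset (Pt d)) :=
  elems.biUnion fun K => K.powersetCard d

/-- A conforming triangulation of `Ω` by `d`-simplices, each given by its set of vertices. Every
edge (or face) `e` comes with a numbering `fst e = K₁`, `snd e = K₂` of the elements it belongs to
(for a boundary edge or face only `fst e` is meaningful). -/
structure Triangulation (d : ℕ) (Ω : Set (Pt d)) where
  elems : Finset (Finset (Pt d))
  card_elem : ∀ K ∈ elems, K.card = d + 1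
  indep : ∀ K ∈ elems, AffineIndependent ℝ ((↑) : K → Pt d)
  inter : ∀ K ∈ elems, ∀ L ∈ elems,
    hull K ∩ hull L ⊆ convexHull ℝ ((K : Set (Pt d)) ∩ (L : Set (Pt d)))
  cover : interior (⋃ K ∈ elems, hull K) = Ω
  fst : Finset (Pt d) → Finset (Pt d)
  snd : Finset (Pt d) → Finset (Pt d)
  fst_mem : ∀ e ∈ facesOf elems, fst e ∈ adjacent elems e
  snd_mem : ∀ e ∈ facesOf elems, (adjacent elems e).Nontrivial →
    snd e ∈ adjacent elems e ∧ snd e ≠ fst e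

/-- A scalar function that is a polynomial on each element `K`, given by its polynomials `q|_K`
(the values at finite sets that are no elements of the triangulation play no role). -/
abbrev ScalarField (d : ℕ) := Finset (Pt d) → MvPolynomial (Fin d) ℝ

/-- A vector field that is polynomial on each element `K`, given by its restrictions `u|_K`. -/
abbrev VectorField (d : ℕ) := Finset (Pt d) → Fin d → MvPolynomial (Fin d) ℝ

/-- The value of a polynomial at a point. -/
def ev (p : MvPolynomial (Fin d) ℝ) (x : Pt d) : ℝ := MvPolynomial.eval (fun i => x i) p

/-- The value of a polynomial vector field at a point. -/
def evV (u : Fin d → MvPolynomial (Fin d) ℝ) (x : Pt d) : Pt d :=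
  WithLp.toLp 2 fun i => ev (u i) x

/-- The entry `ε(u)_ij = (∂_j u_i + ∂_i u_j) / 2` of the strain of a polynomial vector field. -/
def strain (u : Fin d → MvPolynomial (Fin d) ℝ) (i j : Fin d) : MvPolynomial (Fin d) ℝ :=
  MvPolynomial.C (1 / 2 : ℝ) * (MvPolynomial.pderiv j (u i) + MvPolynomial.pderiv i (u j))

/-- The vector `ε(u)(x) ν`. -/
def traction (u : Fin d → MvPolynomial (Fin d) ℝ) (ν x : Pt d) : Pt d :=
  WithLp.toLp 2 fun i => ∑ j, ev (strain u i j) x * ν j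

/-- The tangential component `a - (a · ν) ν`. -/
def tang (ν a : Pt d) : Pt d := a - inner ℝ a ν • ν

/-- The two choices of the local displacement space. -/
inductive Family
  | BDM
  | BDFM

/-- `u ∈ BDM_l(K) = P_l(K)^d`. -/
def IsBDM (l : ℕ) (u : Fin d → MvPolynomial (Fin d) ℝ) : Prop := ∀ i, (u i).totalDegree ≤ l

/-- `u ∈ BDFM_l(K)`: `u ∈ P_l(K)^d` and `u · n ∈ P_{l-1}(e)` on each edge (or face) `e` of `K`. -/
def IsBDFM (l : ℕ) (K : Finset (Pt d)) (u : Fin d → MvPolynomial (Fin d) ℝ) : Prop :=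
  (∀ i, (u i).totalDegree ≤ l) ∧
  ∀ e ∈ K.powersetCard d, ∃ q : MvPolynomial (Fin d) ℝ, q.totalDegree ≤ l - 1 ∧
    ∀ x ∈ hull e, inner ℝ (evV u x) (normal K e) = ev q x

/-- `u` lies in the local displacement space of degree `l ≥ 1`. -/
def Family.IsLocal (F : Family) (l : ℕ) (K : Finset (Pt d))
    (u : Fin d → MvPolynomial (Fin d) ℝ) : Prop :=
  match F with
  | .BDM => IsBDM l u
  | .BDFM => IsBDFM l K u

/-- `v ∈ RT_{l-1}(K) = P_{l-1}(K)^d + x P_{l-1}(K)`, for `l ≥ 1`. -/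
def IsRT (l : ℕ) (v : Fin d → MvPolynomial (Fin d) ℝ) : Prop :=
  ∃ (a : Fin d → MvPolynomial (Fin d) ℝ) (b : MvPolynomial (Fin d) ℝ),
    (∀ i, (a i).totalDegree ≤ l - 1) ∧ b.totalDegree ≤ l - 1 ∧
    ∀ i, v i = a i + MvPolynomial.X i * b

namespace Triangulation

variable {Ω : Set (Pt d)} (T : Triangulation d Ω)

/-- The set of all edges (or faces). -/
def faces : Finset (Finset (Pt d)) := facesOf T.elems

/-- `e` is an interior edge (or face): it belongs to two different elements. -/
def IsInterior (e : Finset (Pt d)) : Prop := (adjacent T.elems e).Nontrivial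

/-- Shape regularity with constant `σ`: every `K` contains a ball whose diameter `2 r` satisfies
`h_K ≤ σ (2 r)`. -/
def ShapeRegular (σ : ℝ) : Prop :=
  ∀ K ∈ T.elems, ∃ (x : Pt d) (r : ℝ), 0 < r ∧ Metric.closedBall x r ⊆ hull K ∧
    Metric.diam (hull K) ≤ σ * (2 * r)

/-- The function on `Ω` (defined up to a null set) with the given restrictions to the elements. -/
def glue (q : ScalarField d) (x : Pt d) : ℝ :=
  ∑ K ∈ T.elems, (interior (hull K)).indicator (ev (q K)) x

/-- The vector field on `Ω` (up to a null set) with the given restrictions to the elements. -/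
def glueV (u : VectorField d) (x : Pt d) : Pt d :=
  ∑ K ∈ T.elems, (interior (hull K)).indicator (evV (u K)) x

/-- `div u` for `u ∈ H(div; Ω)`. -/
def div (u : VectorField d) : Pt d → ℝ := weakDiv Ω (T.glueV u)

/-- `u · n = 0` on `∂Ω`. -/
def NormalVanishes (u : VectorField d) : Prop :=
  ∀ e ∈ T.faces, ¬ T.IsInterior e → ∀ x ∈ hull e,
    inner ℝ (evV (u (T.fst e)) x) (normal (T.fst e) e) = 0

/-- The displacement space `U_h`. -/
def Uh (F : Family) (l : ℕ) : Set (VectorField d) :=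
  {u | MemHDiv Ω (T.glueV u) ∧ (∀ K ∈ T.elems, F.IsLocal l K (u K)) ∧ T.NormalVanishes u}

/-- The flux space `V_{i,h}` (the same for all `i`). -/
def Vh (l : ℕ) : Set (VectorField d) :=
  {v | MemHDiv Ω (T.glueV v) ∧ (∀ K ∈ T.elems, IsRT l (v K)) ∧ T.NormalVanishes v}

/-- The pressure space `P_{i,h}` (the same for all `i`). -/
def Ph (l : ℕ) : Set (ScalarField d) :=
  {q | (∀ K ∈ T.elems, (q K).totalDegree ≤ l - 1) ∧ ∫ x in Ω, T.glue q x = 0}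

open scoped Classical in
/-- The average `{ε(u)}` on the edge (or face) `e`: `(ε(u)|_{K₁} n₁ - ε(u)|_{K₂} n₂) / 2` on an
interior one, `ε(u) n` on a boundary one. -/
def avgStrain (u : VectorField d) (e : Finset (Pt d)) (x : Pt d) : Pt d :=
  if T.IsInterior e then
    (1 / 2 : ℝ) • (traction (u (T.fst e)) (normal (T.fst e) e) x
      - traction (u (T.snd e)) (normal (T.snd e) e) x)
  else traction (u (T.fst e)) (normal (T.fst e) e) x

open scoped Classical in
/-- The jump `[u_t]` of the tangential component on the edge (or face) `e`. -/
def jumpTang (u : VectorField d) (e : Finset (Pt d)) (x : Pt d) : Pt d :=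
  if T.IsInterior e then
    tang (normal (T.fst e) e) (evV (u (T.fst e)) x)
      - tang (normal (T.snd e) e) (evV (u (T.snd e)) x)
  else tang (normal (T.fst e) e) (evV (u (T.fst e)) x)

/-- The integral over an edge (or face), with respect to length (or area). -/
def faceIntegral (e : Finset (Pt d)) (f : Pt d → ℝ) : ℝ := ∫ x in hull e, f x ∂μHE[d - 1]

/-- The bilinear form `a_h` with stabilization parameter `η`. -/
def ah (η : ℝ) (u w : VectorField d) : ℝ :=
  (∑ K ∈ T.elems, ∫ x in hull K, ∑ i, ∑ j, ev (strain (u K) i j) x * ev (strain (w K) i j) x)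
  - (∑ e ∈ T.faces, faceIntegral e fun x => inner ℝ (T.avgStrain u e x) (T.jumpTang w e x))
  - (∑ e ∈ T.faces, faceIntegral e fun x => inner ℝ (T.avgStrain w e x) (T.jumpTang u e x))
  + ∑ e ∈ T.faces, faceIntegral e fun x =>
      η * (Metric.diam (hull e))⁻¹ * inner ℝ (T.jumpTang u e x) (T.jumpTang w e x)

/-- `‖u‖²_DG`. -/
def dgNormSq (u : VectorField d) : ℝ :=
  (∑ K ∈ T.elems, ∫ x in hull K, ∑ i, ∑ j, ev (MvPolynomial.pderiv j (u K i)) x ^ 2)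
  + (∑ e ∈ T.faces,
      (Metric.diam (hull e))⁻¹ * faceIntegral e fun x => ‖T.jumpTang u e x‖ ^ 2)
  + ∑ K ∈ T.elems, Metric.diam (hull K) ^ 2 * ∫ x in hull K,
      ∑ i, ∑ j, ∑ k, ev (MvPolynomial.pderiv k (MvPolynomial.pderiv j (u K i))) x ^ 2

variable {n : ℕ} (M : Params n)

/-- `‖u‖_{U_h} = (‖u‖²_DG + λ ‖div u‖²)^{1/2}`. -/
def normU (u : VectorField d) : ℝ :=
  Real.sqrt (T.dgNormSq u + M.lam * ∫ x in Ω, T.div u x ^ 2)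

/-- `‖v‖_V = (∑_i (R_i⁻¹ v_i, v_i) + (Λ⁻¹ Div v, Div v))^{1/2}`. -/
def normV [NeZero n] (v : Fin n → VectorField d) : ℝ :=
  Real.sqrt ((∑ i, ∫ x in Ω, M.Rinv i * inner ℝ (T.glueV (v i) x) (T.glueV (v i) x))
    + ∫ x in Ω, (M.Lambda⁻¹ *ᵥ fun i => T.div (v i) x) ⬝ᵥ fun i => T.div (v i) x)

/-- `‖p‖_P = (Λ p, p)^{1/2}`. -/
def normP [NeZero n] (p : Fin n → ScalarField d) : ℝ :=
  Real.sqrt (∫ x in Ω, (M.Lambda *ᵥ fun i => T.glue (p i) x) ⬝ᵥ fun i => T.glue (p i) x)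

/-- The bilinear form `𝒜_h((u; v; p), (w; z; q))`. -/
def Ah (η : ℝ) (u : VectorField d) (v : Fin n → VectorField d) (p : Fin n → ScalarField d)
    (w : VectorField d) (z : Fin n → VectorField d) (q : Fin n → ScalarField d) : ℝ :=
  T.ah η u w
  + M.lam * (∫ x in Ω, T.div u x * T.div w x)
  - (∑ i, ∫ x in Ω, T.glue (p i) x * T.div w x)
  + (∑ i, ∫ x in Ω, M.Rinv i * inner ℝ (T.glueV (v i) x) (T.glueV (z i) x))
  - (∑ i, ∫ x in Ω, T.glue (p i) x * T.div (z i) x)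
  - (∑ i, ∫ x in Ω, T.div u x * T.glue (q i) x)
  - (∑ i, ∫ x in Ω, T.div (v i) x * T.glue (q i) x)
  + (∑ i, (-M.alphaP i - M.alphaNet i i) * ∫ x in Ω, T.glue (p i) x * T.glue (q i) x)
  + ∑ i, ∑ j ∈ Finset.univ.erase i,
      M.alphaNet i j * ∫ x in Ω, T.glue (p j) x * T.glue (q i) x

end Triangulation

end MPET

end

open MPET

/-!
Mapping each simplex into the unit ball reduces the discrete trace inequality
`h_e ‖{ε(u)}‖²_{0,e} ≤ C ‖∇u‖²` to a compactness argument for polynomials of bounded degree, with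
constants controlled by the shape regularity; this bounds `a_h` by the DG norm.
The weak divergence of a field in `U_h` is its piecewise divergence, whence
`λ₀ ‖div u‖² ≤ (d + 1) ‖u‖²_{U_h}`. The couplings then follow from the Cauchy-Schwarz inequalities
for `Λ`, `Λ⁻¹` and `Λ₁ + Λ₂ ≤ Λ`, and from `(∑ p_i)² = λ₀ (Λ₄ p, p) ≤ λ₀ (Λ p, p)`.
-/

namespace MPET

variable {d : ℕ}

/-! ### Cauchy–Schwarz inequalities -/

theorem abs_integral_le_sqrt_mul_sqrt {α : Type*} [MeasurableSpace α] {μ : Measure α}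
    {f g k : α → ℝ} (hg : Integrable g μ) (hk : Integrable k μ) (hg0 : 0 ≤ g) (hk0 : 0 ≤ k)
    (h : ∀ x, f x ^ 2 ≤ g x * k x) :
    |∫ x, f x ∂μ| ≤ √(∫ x, g x ∂μ) * √(∫ x, k x ∂μ) := by
  have memLp_sqrt {m : α → ℝ} (hm : Integrable m μ) (hm0 : 0 ≤ m) :
      MemLp (fun x => √(m x)) 2 μ := by
    refine (memLp_two_iff_integrable_sq
      (Real.continuous_sqrt.comp_aestronglyMeasurable hm.1)).2 ?_
    simpa only [Real.sq_sqrt (hm0 _)] using hm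
  have hf (x : α) : ‖f x‖ ≤ √(g x) * √(k x) := by
    rw [← Real.sqrt_mul (hg0 x)]
    exact Real.abs_le_sqrt (h x)
  have holder := integral_mul_le_Lp_mul_Lq_of_nonneg (μ := μ) Real.HolderConjugate.two_two
    (.of_forall fun x => Real.sqrt_nonneg (g x)) (.of_forall fun x => Real.sqrt_nonneg (k x))
    (by simpa using memLp_sqrt hg hg0) (by simpa using memLp_sqrt hk hk0)
  simp only [Real.rpow_two, Real.sq_sqrt (hg0 _), Real.sq_sqrt (hk0 _), ← Real.sqrt_eq_rpow]
    at holder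
  exact (norm_integral_le_of_norm_le ((memLp_sqrt hg hg0).integrable_mul (memLp_sqrt hk hk0))
    (.of_forall hf)).trans holder

theorem abs_sum_le_sqrt_mul_sqrt {ι : Type*} (s : Finset ι) {f g k : ι → ℝ}
    (hg : ∀ i ∈ s, 0 ≤ g i) (hk : ∀ i ∈ s, 0 ≤ k i) (h : ∀ i ∈ s, |f i| ≤ √(g i) * √(k i)) :
    |∑ i ∈ s, f i| ≤ √(∑ i ∈ s, g i) * √(∑ i ∈ s, k i) := by
  rw [← Real.sqrt_mul (Finset.sum_nonneg hg)]
  refine Real.abs_le_sqrt (Finset.sum_sq_le_sum_mul_sum_of_sq_le_mul s hg hk fun i hi => ?_)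
  have hi' := pow_le_pow_left₀ (abs_nonneg _) (h i hi) 2
  rwa [sq_abs, mul_pow, Real.sq_sqrt (hg i hi), Real.sq_sqrt (hk i hi)] at hi'

theorem abs_sum_integral_le_sqrt_mul_sqrt {ι α : Type*} [MeasurableSpace α] (s : Finset ι)
    {μ : ι → Measure α} {f g k : ι → α → ℝ} (hg : ∀ i ∈ s, Integrable (g i) (μ i))
    (hk : ∀ i ∈ s, Integrable (k i) (μ i)) (hg0 : ∀ i ∈ s, 0 ≤ g i) (hk0 : ∀ i ∈ s, 0 ≤ k i)
    (h : ∀ i ∈ s, ∀ x, f i x ^ 2 ≤ g i x * k i x) :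
    |∑ i ∈ s, ∫ x, f i x ∂μ i|
      ≤ √(∑ i ∈ s, ∫ x, g i x ∂μ i) * √(∑ i ∈ s, ∫ x, k i x ∂μ i) :=
  abs_sum_le_sqrt_mul_sqrt s (fun i hi => integral_nonneg (hg0 i hi))
    (fun i hi => integral_nonneg (hk0 i hi)) fun i hi =>
      abs_integral_le_sqrt_mul_sqrt (hg i hi) (hk i hi) (hg0 i hi) (hk0 i hi) (h i hi)

section Matrix

variable {ι : Type*} [Fintype ι] {B : Matrix ι ι ℝ}

theorem mulVec_dotProduct_comm (hB : B.IsHermitian) (x y : ι → ℝ) :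
    B *ᵥ x ⬝ᵥ y = B *ᵥ y ⬝ᵥ x := by
  have hs : Bᵀ = B := (conjTranspose_eq_transpose_of_trivial B).symm.trans hB
  rw [dotProduct_comm, dotProduct_mulVec, ← mulVec_transpose, hs]

theorem mulVec_dotProduct_self_nonneg (hB : B.PosSemidef) (x : ι → ℝ) : 0 ≤ B *ᵥ x ⬝ᵥ x := by
  simpa [dotProduct_comm] using hB.dotProduct_mulVec_nonneg x

theorem mulVec_dotProduct_sq_le (hB : B.PosSemidef) (x y : ι → ℝ) :
    (B *ᵥ x ⬝ᵥ y) ^ 2 ≤ (B *ᵥ x ⬝ᵥ x) * (B *ᵥ y ⬝ᵥ y) := by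
  classical
  have apply (a b : ι → ℝ) : toBilin' B a b = B *ᵥ b ⬝ᵥ a := by
    rw [toBilin'_apply', dotProduct_comm]
  have := LinearMap.BilinForm.apply_sq_le_of_symm (toBilin' B)
    (fun z => by rw [apply]; exact mulVec_dotProduct_self_nonneg hB z)
    ⟨fun a b => by rw [RingHom.id_apply, apply, apply, mulVec_dotProduct_comm hB.1]⟩ y x
  rwa [apply, apply, apply, mul_comm] at this

theorem dotProduct_sq_le_mul_inv [DecidableEq ι] (hB : B.PosDef) (x y : ι → ℝ) :
    (x ⬝ᵥ y) ^ 2 ≤ (B *ᵥ x ⬝ᵥ x) * (B⁻¹ *ᵥ y ⬝ᵥ y) := by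
  have hy : B *ᵥ (B⁻¹ *ᵥ y) = y := by
    rw [mulVec_mulVec, mul_nonsing_inv _ ((isUnit_iff_isUnit_det B).1 hB.isUnit), one_mulVec]
  have := mulVec_dotProduct_sq_le hB.posSemidef x (B⁻¹ *ᵥ y)
  rwa [mulVec_dotProduct_comm hB.1 x, hy, dotProduct_comm y, dotProduct_comm y] at this

end Matrix

/-! ### Polynomials and inverse estimates -/

section Polynomial

variable {ι κ R : Type*} [CommSemiring R]

theorem totalDegree_pderiv_le (i : ι) (p : MvPolynomial ι R) :
    (MvPolynomial.pderiv i p).totalDegree ≤ p.totalDegree := by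
  conv_lhs => rw [p.as_sum, map_sum]
  refine MvPolynomial.totalDegree_finsetSum_le fun m hm => ?_
  rw [MvPolynomial.pderiv_monomial]
  calc _ ≤ (m - Finsupp.single i 1).degree := MvPolynomial.totalDegree_monomial_le _ _
    _ ≤ m.degree := Finsupp.degree_mono tsub_le_self
    _ ≤ p.totalDegree := MvPolynomial.le_totalDegree hm

theorem totalDegree_aeval_le {f : ι → MvPolynomial κ R} (hf : ∀ i, (f i).totalDegree ≤ 1)
    (p : MvPolynomial ι R) : (MvPolynomial.aeval f p).totalDegree ≤ p.totalDegree := by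
  rw [MvPolynomial.aeval_def, MvPolynomial.eval₂_eq]
  refine MvPolynomial.totalDegree_finsetSum_le fun m hm => ?_
  calc (algebraMap R _ (p.coeff m) * ∏ i ∈ m.support, f i ^ m i).totalDegree
      ≤ 0 + (∏ i ∈ m.support, f i ^ m i).totalDegree := by
        simpa [MvPolynomial.algebraMap_eq] using
          MvPolynomial.totalDegree_mul (MvPolynomial.C (p.coeff m)) (∏ i ∈ m.support, f i ^ m i)
    _ ≤ ∑ i ∈ m.support, (f i ^ m i).totalDegree := by
        rw [zero_add]; exact MvPolynomial.totalDegree_finsetProd _ _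
    _ ≤ m.degree := Finset.sum_le_sum fun i _ =>
        (MvPolynomial.totalDegree_pow _ _).trans (mul_le_of_le_one_right' (hf i))
    _ ≤ p.totalDegree := MvPolynomial.le_totalDegree hm

end Polynomial

theorem exists_norm_le_mul_norm_of_injective {𝕜 V E F : Type*} [NontriviallyNormedField 𝕜]
    [CompleteSpace 𝕜] [AddCommGroup V] [Module 𝕜 V] [FiniteDimensional 𝕜 V]
    [NormedAddCommGroup E] [NormedSpace 𝕜 E] [NormedAddCommGroup F] [NormedSpace 𝕜 F]
    {φ : V →ₗ[𝕜] E} (hφ : Function.Injective φ) (ψ : V →ₗ[𝕜] F) :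
    ∃ C : ℝ, 0 ≤ C ∧ ∀ v, ‖ψ v‖ ≤ C * ‖φ v‖ := by
  let e := LinearEquiv.ofInjective φ hφ
  let A := (ψ ∘ₗ e.symm.toLinearMap).toContinuousLinearMap
  exact ⟨‖A‖, norm_nonneg A, fun v => by simpa [A, e] using A.le_opNorm (e v)⟩

theorem memLp_restrict_of_continuous {X E : Type*} [PseudoMetricSpace X] [ProperSpace X]
    [MeasurableSpace X] [OpensMeasurableSpace X] [NormedAddCommGroup E]
    [SecondCountableTopologyEither X E] {μ : Measure X} {s : Set X}
    (hs : Bornology.IsBounded s) (hm : MeasurableSet s) (hμ : μ s < ⊤) {f : X → E}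
    (hf : Continuous f) (p : ENNReal) : MemLp f p (μ.restrict s) := by
  have : IsFiniteMeasure (μ.restrict s) := ⟨by simpa using hμ⟩
  obtain ⟨B, hB⟩ := hs.isCompact_closure.exists_bound_of_continuousOn hf.continuousOn
  exact MemLp.of_bound hf.aestronglyMeasurable B
    (ae_restrict_of_forall_mem hm fun x hx => hB x (subset_closure hx))

@[fun_prop]
theorem continuous_ev (p : MvPolynomial (Fin d) ℝ) : Continuous (ev p) :=
  p.continuous_eval.comp (by fun_prop)

@[fun_prop]
theorem continuous_evV (u : Fin d → MvPolynomial (Fin d) ℝ) : Continuous (evV u) := by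
  unfold evV
  fun_prop

theorem eq_zero_of_ev_eq_zero_on_ball {p : MvPolynomial (Fin d) ℝ}
    (h : ∀ x ∈ Metric.ball (0 : Pt d) 1, ev p x = 0) : p = 0 := by
  have hU : (fun x : Fin d → ℝ => WithLp.toLp 2 x) ⁻¹' Metric.ball (0 : Pt d) 1 ∈
      nhds (0 : Fin d → ℝ) :=
    ContinuousAt.preimage_mem_nhds (by fun_prop) (Metric.ball_mem_nhds _ one_pos)
  obtain ⟨ε, hε, hball⟩ := Metric.mem_nhds_iff.1 hU
  refine MvPolynomial.funext_set (fun _ => Metric.ball (0 : ℝ) ε) (fun _ => ?_) fun x hx => ?_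
  · rw [Real.ball_eq_Ioo]
    exact Set.Ioo_infinite (by linarith)
  · rw [map_zero]
    exact h _ (hball (by rwa [ball_pi _ hε]))

theorem memLp_ev_unitBall (p : MvPolynomial (Fin d) ℝ) :
    MemLp (ev p) 2 (volume.restrict (Metric.ball (0 : Pt d) 1)) :=
  memLp_restrict_of_continuous Metric.isBounded_ball measurableSet_ball measure_ball_lt_top
    (continuous_ev p) 2

/-- A polynomial as an element of `L²` of the unit ball. -/
noncomputable def unitBallLp : MvPolynomial (Fin d) ℝ →ₗ[ℝ]
    Lp ℝ 2 ((volume : Measure (Pt d)).restrict (Metric.ball 0 1)) where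
  toFun p := (memLp_ev_unitBall p).toLp _
  map_add' p q := by
    rw [← MemLp.toLp_add]; congr 1; funext x; simp [ev]
  map_smul' c p := by
    rw [RingHom.id_apply, ← MemLp.toLp_const_smul]; congr 1; funext x; simp [ev]

/-- A polynomial as a continuous function on the ball of radius `R`. -/
noncomputable def closedBallMap (R : ℝ) :
    MvPolynomial (Fin d) ℝ →ₗ[ℝ] C(Metric.closedBall (0 : Pt d) R, ℝ) where
  toFun p := ⟨fun y => ev p y, by fun_prop⟩
  map_add' p q := by ext; simp [ev]
  map_smul' c p := by ext; simp [ev]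

theorem norm_unitBallLp_sq (p : MvPolynomial (Fin d) ℝ) :
    ‖unitBallLp p‖ ^ 2 = ∫ x in Metric.ball (0 : Pt d) 1, ev p x ^ 2 := by
  rw [← real_inner_self_eq_norm_sq, L2.inner_def]
  refine integral_congr_ae ?_
  filter_upwards [(memLp_ev_unitBall p).coeFn_toLp] with x hx
  have hx' : unitBallLp p x = ev p x := hx
  rw [hx', real_inner_self_eq_norm_sq, Real.norm_eq_abs, sq_abs]

theorem unitBallLp_injective : Function.Injective (unitBallLp (d := d)) := by
  refine (injective_iff_map_eq_zero _).2 fun p hp => eq_zero_of_ev_eq_zero_on_ball fun x hx => ?_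
  have h0 : ev p =ᵐ[volume.restrict (Metric.ball 0 1)] 0 :=
    (memLp_ev_unitBall p).coeFn_toLp.symm.trans
      (((Lp.ext_iff).1 hp).trans (Lp.coeFn_zero _ _ _))
  exact Measure.eqOn_open_of_ae_eq h0 Metric.isOpen_ball (continuous_ev p).continuousOn
    continuousOn_const hx

theorem exists_ev_sq_le_integral_unitBall (d l : ℕ) (R : ℝ) :
    ∃ C : ℝ, 0 ≤ C ∧ ∀ p : MvPolynomial (Fin d) ℝ, p.totalDegree ≤ l →
      ∀ y : Pt d, ‖y‖ ≤ R → ev p y ^ 2 ≤ C * ∫ x in Metric.ball (0 : Pt d) 1, ev p x ^ 2 := by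
  let P := MvPolynomial.restrictTotalDegree (Fin d) ℝ l
  obtain ⟨C, -, h⟩ := exists_norm_le_mul_norm_of_injective (φ := unitBallLp ∘ₗ P.subtype)
    (unitBallLp_injective.comp P.subtype_injective) (closedBallMap R ∘ₗ P.subtype)
  refine ⟨C ^ 2, by positivity, fun p hp y hy => ?_⟩
  have hpy : |ev p y| ≤ C * ‖unitBallLp p‖ :=
    ((closedBallMap R p).norm_coe_le_norm ⟨y, by simpa using hy⟩).trans
      (h ⟨p, (MvPolynomial.mem_restrictTotalDegree _ _ _).2 hp⟩)
  calc ev p y ^ 2 ≤ (C * ‖unitBallLp p‖) ^ 2 := sq_le_sq' (abs_le.1 hpy).1 (abs_le.1 hpy).2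
    _ = C ^ 2 * ∫ x in Metric.ball (0 : Pt d) 1, ev p x ^ 2 := by
        rw [mul_pow, norm_unitBallLp_sq]

theorem setIntegral_unitBall_comp_add_smul {E : Type*} [NormedAddCommGroup E] [NormedSpace ℝ E]
    (f : Pt d → E) (x : Pt d) {r : ℝ} (hr : 0 < r) :
    ∫ z in Metric.ball (0 : Pt d) 1, f (x + r • z)
      = (r ^ d)⁻¹ • ∫ z in Metric.ball x r, f z := by
  rw [Measure.setIntegral_comp_smul_of_pos volume (fun z => f (x + z)) _ hr,
    smul_unitBall_of_pos hr, finrank_euclideanSpace_fin]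
  have translate := (measurePreserving_add_left volume x).setIntegral_preimage_emb
    (measurableEmbedding_addLeft x) f (Metric.ball x r)
  rw [← translate, preimage_add_ball, sub_self]

theorem exists_ev_sq_le_integral_ball (d l : ℕ) (R : ℝ) :
    ∃ C : ℝ, 0 ≤ C ∧ ∀ p : MvPolynomial (Fin d) ℝ, p.totalDegree ≤ l →
      ∀ (x : Pt d) (r : ℝ), 0 < r → ∀ y, dist y x ≤ R * r →
        r ^ d * ev p y ^ 2 ≤ C * ∫ z in Metric.ball x r, ev p z ^ 2 := by
  obtain ⟨C, hC, h⟩ := exists_ev_sq_le_integral_unitBall d l R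
  refine ⟨C, hC, fun p hp x r hr y hy => ?_⟩
  let f (i : Fin d) : MvPolynomial (Fin d) ℝ :=
    MvPolynomial.C (x i) + MvPolynomial.C r * MvPolynomial.X i
  let q := MvPolynomial.aeval f p
  have hf (i : Fin d) : (f i).totalDegree ≤ 1 := by
    refine (MvPolynomial.totalDegree_add _ _).trans (max_le (by simp) ?_)
    exact (MvPolynomial.totalDegree_mul _ _).trans (by simp)
  have ev_q (z : Pt d) : ev q z = ev p (x + r • z) := by
    change MvPolynomial.eval₂Hom (RingHom.id ℝ) _ (MvPolynomial.bind₁ f p)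
      = MvPolynomial.eval₂Hom (RingHom.id ℝ) _ p
    rw [MvPolynomial.eval₂Hom_bind₁]
    congr 2
    funext i
    simp [f]
  have hyn : ‖r⁻¹ • (y - x)‖ ≤ R := by
    rwa [norm_smul, norm_inv, Real.norm_of_nonneg hr.le, ← dist_eq_norm, inv_mul_le_iff₀ hr,
      mul_comm]
  have hq := h q ((totalDegree_aeval_le hf p).trans hp) _ hyn
  simp only [ev_q, smul_inv_smul₀ hr.ne', add_sub_cancel] at hq
  rw [setIntegral_unitBall_comp_add_smul (fun z => ev p z ^ 2) x hr, smul_eq_mul] at hq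
  calc r ^ d * ev p y ^ 2
      ≤ r ^ d * (C * ((r ^ d)⁻¹ * ∫ z in Metric.ball x r, ev p z ^ 2)) := by gcongr
    _ = C * ∫ z in Metric.ball x r, ev p z ^ 2 := by field_simp

/-! ### Simplices -/

theorem euclideanHausdorffMeasure_le_of_finrank_vectorSpan {E : Type*} [NormedAddCommGroup E]
    [InnerProductSpace ℝ E] [FiniteDimensional ℝ E] [MeasurableSpace E] [BorelSpace E] {s : Set E}
    (hs : Bornology.IsBounded s) {k : ℕ} (hk : Module.finrank ℝ (vectorSpan ℝ s) = k) :
    μHE[k] s ≤ ENNReal.ofReal (Metric.diam s ^ k) * volume (Metric.ball (0 : Pt k) 1) := by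
  rcases s.eq_empty_or_nonempty with rfl | ⟨p, hp⟩
  · simp
  let b := (stdOrthonormalBasis ℝ (vectorSpan ℝ s)).reindex (finCongr hk)
  let φ : Pt k → E := fun z => p + (b.repr.symm z : E)
  have hφ : Isometry φ := Isometry.of_dist_eq fun y z => by
    simp only [φ, dist_add_left, ← Subtype.dist_eq]
    exact b.repr.symm.dist_map y z
  have hsub : s ⊆ φ '' Metric.closedBall 0 (Metric.diam s) := by
    intro y hy
    refine ⟨b.repr ⟨y - p, vsub_mem_vectorSpan ℝ hy hp⟩, ?_, by simp [φ]⟩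
    rw [mem_closedBall_zero_iff, LinearIsometryEquiv.norm_map, Submodule.coe_norm, ← dist_eq_norm]
    exact Metric.dist_le_diam_of_mem hs hy hp
  calc μHE[k] s ≤ μHE[k] (φ '' Metric.closedBall 0 (Metric.diam s)) := measure_mono hsub
    _ = volume (Metric.closedBall (0 : Pt k) (Metric.diam s)) := by
        rw [hφ.euclideanHausdorffMeasure_image, EuclideanSpace.euclideanHausdorffMeasure_eq_volume]
    _ = _ := by
        rw [Measure.addHaar_closedBall _ _ Metric.diam_nonneg, finrank_euclideanSpace_fin]

/-- The shape regularity condition of a single simplex: `K` contains a ball whose diameter `2 r`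
satisfies `h_K ≤ σ (2 r)`. -/
def IsShapeRegular (σ : ℝ) (K : Finset (Pt d)) : Prop :=
  ∃ (x : Pt d) (r : ℝ), 0 < r ∧ Metric.closedBall x r ⊆ hull K ∧
    Metric.diam (hull K) ≤ σ * (2 * r)

theorem isCompact_hull (K : Finset (Pt d)) : IsCompact (hull K) :=
  K.finite_toSet.isCompact_convexHull ℝ

theorem isBounded_hull (K : Finset (Pt d)) : Bornology.IsBounded (hull K) :=
  (isCompact_hull K).isBounded

theorem measurableSet_hull (K : Finset (Pt d)) : MeasurableSet (hull K) :=
  (isCompact_hull K).isClosed.measurableSet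

theorem hull_mono {e K : Finset (Pt d)} (h : e ⊆ K) : hull e ⊆ hull K :=
  convexHull_mono (Finset.coe_subset.2 h)

theorem diam_hull_mono {e K : Finset (Pt d)} (h : e ⊆ K) :
    Metric.diam (hull e) ≤ Metric.diam (hull K) :=
  Metric.diam_mono (hull_mono h) (isBounded_hull K)

theorem diam_hull_pos {e : Finset (Pt d)} (hc : 2 ≤ e.card) : 0 < Metric.diam (hull e) := by
  obtain ⟨a, ha, b, hb, hab⟩ := Finset.one_lt_card.1 hc
  exact (dist_pos.2 hab).trans_le (Metric.dist_le_diam_of_mem (isBounded_hull e)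
    (subset_convexHull ℝ _ ha) (subset_convexHull ℝ _ hb))

theorem memLp_hull {E : Type*} [NormedAddCommGroup E] (K : Finset (Pt d)) {f : Pt d → E}
    (hf : Continuous f) (p : ENNReal) : MemLp f p (volume.restrict (hull K)) :=
  memLp_restrict_of_continuous (isBounded_hull K) (measurableSet_hull K)
    (isCompact_hull K).measure_lt_top hf p

theorem integrable_hull {K : Finset (Pt d)} {f : Pt d → ℝ} (hf : Continuous f) :
    Integrable f (volume.restrict (hull K)) :=
  memLp_one_iff_integrable.1 (memLp_hull K hf 1)

section Subsimplex

variable {e : Finset (Pt d)} {k : ℕ} (he : AffineIndependent ℝ ((↑) : e → Pt d))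
  (hk : e.card = k + 1)

include he hk

theorem euclideanHausdorffMeasure_hull_le :
    μHE[k] (hull e) ≤ ENNReal.ofReal (Metric.diam (hull e) ^ k) *
      volume (Metric.ball (0 : Pt k) 1) := by
  refine euclideanHausdorffMeasure_le_of_finrank_vectorSpan (isBounded_hull e) ?_
  rw [hull, ← direction_affineSpan, affineSpan_convexHull, direction_affineSpan,
    ← Subtype.range_coe (s := (e : Set (Pt d)))]
  exact he.finrank_vectorSpan (by simpa using hk)

theorem euclideanHausdorffMeasure_hull_lt_top : μHE[k] (hull e) < ⊤ :=
  (euclideanHausdorffMeasure_hull_le he hk).trans_lt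
    (ENNReal.mul_lt_top ENNReal.ofReal_lt_top measure_ball_lt_top)

theorem measureReal_hull_le :
    (μHE[k] : Measure (Pt d)).real (hull e) ≤
      Metric.diam (hull e) ^ k * (volume : Measure (Pt k)).real (Metric.ball 0 1) := by
  have h := ENNReal.toReal_mono
    (ENNReal.mul_lt_top ENNReal.ofReal_lt_top measure_ball_lt_top).ne
    (euclideanHausdorffMeasure_hull_le he hk)
  rwa [ENNReal.toReal_mul, ENNReal.toReal_ofReal (pow_nonneg Metric.diam_nonneg k)] at h

theorem integrable_subsimplex {f : Pt d → ℝ} (hf : Continuous f) :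
    Integrable f (μHE[k].restrict (hull e)) :=
  memLp_one_iff_integrable.1 (memLp_restrict_of_continuous (isBounded_hull e)
    (measurableSet_hull e) (euclideanHausdorffMeasure_hull_lt_top he hk) hf 1)

end Subsimplex

theorem exists_diam_pow_mul_ev_sq_le (d l : ℕ) (σ : ℝ) :
    ∃ C : ℝ, 0 ≤ C ∧ ∀ K : Finset (Pt d), IsShapeRegular σ K →
      ∀ p : MvPolynomial (Fin d) ℝ, p.totalDegree ≤ l → ∀ y ∈ hull K,
        Metric.diam (hull K) ^ d * ev p y ^ 2 ≤ C * ∫ x in hull K, ev p x ^ 2 := by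
  obtain ⟨C, hC, h⟩ := exists_ev_sq_le_integral_ball d l (2 * σ)
  refine ⟨|2 * σ| ^ d * C, by positivity, ?_⟩
  rintro K ⟨x, r, hr, hball, hdiam⟩ p hp y hy
  have hdist : dist y x ≤ 2 * σ * r := by
    linarith [Metric.dist_le_diam_of_mem (isBounded_hull K) hy
      (hball (Metric.mem_closedBall_self hr.le))]
  have hdiam' : Metric.diam (hull K) ≤ |2 * σ| * r := by nlinarith [le_abs_self (2 * σ)]
  calc Metric.diam (hull K) ^ d * ev p y ^ 2
      ≤ (|2 * σ| * r) ^ d * ev p y ^ 2 := by gcongr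
    _ = |2 * σ| ^ d * (r ^ d * ev p y ^ 2) := by ring
    _ ≤ |2 * σ| ^ d * (C * ∫ z in Metric.ball x r, ev p z ^ 2) := by
        gcongr ?_ * ?_
        exact h p hp x r hr y hdist
    _ ≤ |2 * σ| ^ d * (C * ∫ z in hull K, ev p z ^ 2) := by
        gcongr ?_ * (?_ * ?_)
        exact setIntegral_mono_set (integrable_hull ((continuous_ev p).pow 2))
          (.of_forall fun z => sq_nonneg _) (Metric.ball_subset_closedBall.trans hball).eventuallyLE
    _ = |2 * σ| ^ d * C * ∫ z in hull K, ev p z ^ 2 := by ring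

theorem exists_trace_le (d k l : ℕ) (hkd : k ≤ d) (σ : ℝ) :
    ∃ C : ℝ, 0 ≤ C ∧ ∀ K e : Finset (Pt d), IsShapeRegular σ K → e ⊆ K →
      AffineIndependent ℝ ((↑) : e → Pt d) → e.card = k + 1 →
      ∀ p : MvPolynomial (Fin d) ℝ, p.totalDegree ≤ l →
        Metric.diam (hull K) ^ (d - k) * ∫ x in hull e, ev p x ^ 2 ∂μHE[k]
          ≤ C * ∫ x in hull K, ev p x ^ 2 := by
  obtain ⟨C, hC, h⟩ := exists_diam_pow_mul_ev_sq_le d l σ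
  set v := (volume : Measure (Pt k)).real (Metric.ball 0 1)
  refine ⟨C * v, by positivity, fun K e hK heK he hk p hp => ?_⟩
  set D := Metric.diam (hull K)
  set I := ∫ x in hull K, ev p x ^ 2
  have : 0 ≤ I := integral_nonneg fun x => sq_nonneg _
  have hD : 0 < D ^ k := by
    rcases k.eq_zero_or_pos with rfl | hkpos
    · simp
    · exact pow_pos ((diam_hull_pos (by omega)).trans_le (diam_hull_mono heK)) k
  have hpointwise (y : Pt d) (hy : y ∈ hull e) : ‖D ^ d * ev p y ^ 2‖ ≤ C * I := by
    rw [Real.norm_of_nonneg (mul_nonneg (pow_nonneg Metric.diam_nonneg d) (sq_nonneg _))]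
    exact h K hK p hp y (hull_mono heK hy)
  refine le_of_mul_le_mul_left ?_ hD
  calc D ^ k * (D ^ (d - k) * ∫ x in hull e, ev p x ^ 2 ∂μHE[k])
      = ∫ x in hull e, D ^ d * ev p x ^ 2 ∂μHE[k] := by
        rw [integral_const_mul, ← mul_assoc, ← pow_add, Nat.add_sub_of_le hkd]
    _ ≤ C * I * (μHE[k] : Measure (Pt d)).real (hull e) :=
        (Real.le_norm_self _).trans (norm_setIntegral_le_of_norm_le_const
          (euclideanHausdorffMeasure_hull_lt_top he hk) hpointwise)
    _ ≤ C * I * (Metric.diam (hull e) ^ k * v) := by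
        gcongr
        exact measureReal_hull_le he hk
    _ ≤ C * I * (D ^ k * v) := by
        gcongr
        exact diam_hull_mono heK
    _ = D ^ k * (C * v * I) := by ring

/-! ### Strains, tractions and the form `a_h` -/

section Strain

variable (u w : Fin d → MvPolynomial (Fin d) ℝ)

/-- `|∇u(x)|²`. -/
noncomputable def gradSq (x : Pt d) : ℝ := ∑ i, ∑ j, ev (MvPolynomial.pderiv j (u i)) x ^ 2

/-- `|ε(u)(x)|²`. -/
noncomputable def strainSq (x : Pt d) : ℝ := ∑ i, ∑ j, ev (strain u i j) x ^ 2

theorem gradSq_nonneg : 0 ≤ gradSq u := fun x => by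
  unfold gradSq
  positivity

theorem strainSq_nonneg : 0 ≤ strainSq u := fun x => by
  unfold strainSq
  positivity

@[fun_prop]
theorem continuous_gradSq : Continuous (gradSq u) := by
  unfold gradSq
  fun_prop

@[fun_prop]
theorem continuous_strainSq : Continuous (strainSq u) := by
  unfold strainSq
  fun_prop

@[fun_prop]
theorem continuous_traction (ν : Pt d) : Continuous (traction u ν) := by
  unfold traction
  fun_prop

theorem strainSq_le_gradSq (x : Pt d) : strainSq u x ≤ gradSq u x := by
  have entry (i j : Fin d) : ev (strain u i j) x ^ 2
      ≤ (ev (MvPolynomial.pderiv j (u i)) x ^ 2 + ev (MvPolynomial.pderiv i (u j)) x ^ 2) / 2 := by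
    have : ev (strain u i j) x = 1 / 2 * (ev (MvPolynomial.pderiv j (u i)) x
        + ev (MvPolynomial.pderiv i (u j)) x) := by simp [ev, strain]
    rw [this]
    linarith [add_sq_le (a := ev (MvPolynomial.pderiv j (u i)) x)
      (b := ev (MvPolynomial.pderiv i (u j)) x)]
  calc strainSq u x ≤ ∑ i, ∑ j, (ev (MvPolynomial.pderiv j (u i)) x ^ 2
        + ev (MvPolynomial.pderiv i (u j)) x ^ 2) / 2 :=
        Finset.sum_le_sum fun i _ => Finset.sum_le_sum fun j _ => entry i j
    _ = (gradSq u x + gradSq u x) / 2 := by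
        simp only [← Finset.sum_div, Finset.sum_add_distrib]
        rw [Finset.sum_comm (f := fun i j => ev (MvPolynomial.pderiv i (u j)) x ^ 2)]
        rfl
    _ = gradSq u x := add_self_div_two _

theorem sum_strain_mul_strain_sq_le (x : Pt d) :
    (∑ i, ∑ j, ev (strain u i j) x * ev (strain w i j) x) ^ 2 ≤ strainSq u x * strainSq w x := by
  simp only [strainSq, ← Fintype.sum_prod_type']
  exact Finset.sum_mul_sq_le_sq_mul_sq _ _ _

theorem norm_traction_sq_le (ν x : Pt d) :
    ‖traction u ν x‖ ^ 2 ≤ strainSq u x * ‖ν‖ ^ 2 := by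
  rw [EuclideanSpace.real_norm_sq_eq, EuclideanSpace.real_norm_sq_eq, strainSq, Finset.sum_mul]
  refine Finset.sum_le_sum fun i _ => ?_
  change (∑ j, ev (strain u i j) x * ν j) ^ 2 ≤ _
  exact Finset.sum_mul_sq_le_sq_mul_sq _ _ _

theorem integral_strainSq {μ : Measure (Pt d)} (hμ : ∀ f : Pt d → ℝ, Continuous f →
    Integrable f μ) : ∫ x, strainSq u x ∂μ = ∑ i, ∑ j, ∫ x, ev (strain u i j) x ^ 2 ∂μ := by
  unfold strainSq
  rw [integral_finsetSum _ fun i _ => hμ _ (by fun_prop)]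
  exact Finset.sum_congr rfl fun i _ => integral_finsetSum _ fun j _ => hμ _ (by fun_prop)

variable {u} in
theorem totalDegree_strain_le {l : ℕ} (hu : ∀ i, (u i).totalDegree ≤ l) (i j : Fin d) :
    (strain u i j).totalDegree ≤ l := by
  refine (MvPolynomial.totalDegree_mul _ _).trans ?_
  rw [MvPolynomial.totalDegree_C, zero_add]
  exact (MvPolynomial.totalDegree_add _ _).trans (max_le ((totalDegree_pderiv_le _ _).trans (hu i))
    ((totalDegree_pderiv_le _ _).trans (hu j)))

end Strain

theorem norm_normal_le (K e : Finset (Pt d)) : ‖normal K e‖ ≤ 1 := by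
  rw [normal]
  set a := (vectorSpan ℝ (e : Set (Pt d)))ᗮ.starProjection (e.centroid ℝ id - K.centroid ℝ id)
  rcases eq_or_ne a 0 with h | h
  · simp [h]
  · rw [NormedSpace.norm_normalize h]

theorem exists_trace_traction_le (hd : 1 ≤ d) (l : ℕ) (σ : ℝ) :
    ∃ C : ℝ, 0 ≤ C ∧ ∀ K e : Finset (Pt d), IsShapeRegular σ K → e ⊆ K →
      AffineIndependent ℝ ((↑) : e → Pt d) → e.card = d →
      ∀ u : Fin d → MvPolynomial (Fin d) ℝ, (∀ i, (u i).totalDegree ≤ l) →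
        Metric.diam (hull e) * ∫ x in hull e, ‖traction u (normal K e) x‖ ^ 2 ∂μHE[d - 1]
          ≤ C * ∫ x in hull K, gradSq u x := by
  obtain ⟨C, hC, trace⟩ := exists_trace_le d (d - 1) l (Nat.sub_le d 1) σ
  rw [Nat.sub_sub_self hd] at trace
  simp only [pow_one] at trace
  refine ⟨C, hC, fun K e hK heK he hc u hu => ?_⟩
  have hint (f : Pt d → ℝ) (hf : Continuous f) : Integrable f (μHE[d - 1].restrict (hull e)) :=
    integrable_subsimplex he (by omega) hf
  have traction_le (x : Pt d) : ‖traction u (normal K e) x‖ ^ 2 ≤ strainSq u x :=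
    (norm_traction_sq_le u _ x).trans (mul_le_of_le_one_right (strainSq_nonneg u x)
      (pow_le_one₀ (norm_nonneg _) (norm_normal_le K e)))
  calc Metric.diam (hull e) * ∫ x in hull e, ‖traction u (normal K e) x‖ ^ 2 ∂μHE[d - 1]
      ≤ Metric.diam (hull K) * ∫ x in hull e, strainSq u x ∂μHE[d - 1] :=
        mul_le_mul (diam_hull_mono heK)
          (integral_mono (hint _ (by fun_prop)) (hint _ (by fun_prop)) traction_le)
          (integral_nonneg fun x => sq_nonneg _) Metric.diam_nonneg
    _ = ∑ i, ∑ j, Metric.diam (hull K) * ∫ x in hull e, ev (strain u i j) x ^ 2 ∂μHE[d - 1] := by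
        simp only [integral_strainSq u hint, Finset.mul_sum]
    _ ≤ ∑ i, ∑ j, C * ∫ x in hull K, ev (strain u i j) x ^ 2 :=
        Finset.sum_le_sum fun i _ => Finset.sum_le_sum fun j _ =>
          trace K e hK heK he (by omega) _ (totalDegree_strain_le hu i j)
    _ = C * ∫ x in hull K, strainSq u x := by
        simp only [integral_strainSq u fun _ => integrable_hull, Finset.mul_sum]
    _ ≤ C * ∫ x in hull K, gradSq u x := by
        exact mul_le_mul_of_nonneg_left (integral_mono (integrable_hull (by fun_prop))
          (integrable_hull (by fun_prop)) (strainSq_le_gradSq u)) hC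

namespace Triangulation

section

variable {Ω : Set (Pt d)} (T : Triangulation d Ω) {u w : VectorField d} {e : Finset (Pt d)}

/-- The restrictions `u|_K` have degree at most `l`. -/
def DegreeLE (l : ℕ) (u : VectorField d) : Prop :=
  ∀ K ∈ T.elems, ∀ i, (u K i).totalDegree ≤ l

/-- `∑_K ‖∇u‖²_{0,K}`. -/
noncomputable def gradNormSq (u : VectorField d) : ℝ :=
  ∑ K ∈ T.elems, ∫ x in hull K, gradSq (u K) x

/-- `∑_e h_e⁻¹ ‖[u_t]‖²_{0,e}`. -/
noncomputable def jumpNormSq (u : VectorField d) : ℝ :=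
  ∑ e ∈ T.faces, (Metric.diam (hull e))⁻¹ * faceIntegral e fun x => ‖T.jumpTang u e x‖ ^ 2

/-- `∑_e h_e ‖{ε(u)}‖²_{0,e}`. -/
noncomputable def avgNormSq (u : VectorField d) : ℝ :=
  ∑ e ∈ T.faces, Metric.diam (hull e) * faceIntegral e fun x => ‖T.avgStrain u e x‖ ^ 2

variable (u) in
theorem gradNormSq_nonneg : 0 ≤ T.gradNormSq u :=
  Finset.sum_nonneg fun K _ => integral_nonneg (gradSq_nonneg (u K))

variable (u) in
theorem jumpNormSq_nonneg : 0 ≤ T.jumpNormSq u :=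
  Finset.sum_nonneg fun _ _ => mul_nonneg (inv_nonneg.2 Metric.diam_nonneg)
    (integral_nonneg fun _ => sq_nonneg _)

variable (u) in
theorem gradNormSq_add_jumpNormSq_le : T.gradNormSq u + T.jumpNormSq u ≤ T.dgNormSq u :=
  le_add_of_nonneg_right (Finset.sum_nonneg fun K _ =>
    mul_nonneg (sq_nonneg _) (integral_nonneg fun x => by positivity))

variable (u e) in
@[fun_prop]
theorem continuous_avgStrain : Continuous (T.avgStrain u e) := by
  unfold avgStrain
  split_ifs <;> fun_prop

variable (u e) in
@[fun_prop]
theorem continuous_jumpTang : Continuous (T.jumpTang u e) := by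
  unfold jumpTang tang
  split_ifs <;> fun_prop

theorem mem_faces : e ∈ T.faces ↔ ∃ K ∈ T.elems, e ⊆ K ∧ e.card = d := by
  simp [faces, facesOf, Finset.mem_powersetCard]

theorem card_of_mem_faces (he : e ∈ T.faces) : e.card = d := by
  obtain ⟨K, -, -, h⟩ := T.mem_faces.1 he
  exact h

theorem affineIndependent_of_mem_faces (he : e ∈ T.faces) :
    AffineIndependent ℝ ((↑) : e → Pt d) := by
  obtain ⟨K, hK, h, -⟩ := T.mem_faces.1 he
  exact AffineIndependent.mono (t := (K : Set (Pt d))) (s := (e : Set (Pt d))) (T.indep K hK)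
    (Finset.coe_subset.2 h)

theorem integrable_of_mem_faces (hd : 1 ≤ d) (he : e ∈ T.faces) {f : Pt d → ℝ}
    (hf : Continuous f) : Integrable f (μHE[d - 1].restrict (hull e)) := by
  have := T.card_of_mem_faces he
  exact integrable_subsimplex (T.affineIndependent_of_mem_faces he) (by omega) hf

open scoped Classical in
theorem sum_faces_sum_elems_le {g : Finset (Pt d) → ℝ} (hg : ∀ K ∈ T.elems, 0 ≤ g K) :
    ∑ e ∈ T.faces, ∑ K ∈ T.elems with e ⊆ K, g K ≤ (d + 1) * ∑ K ∈ T.elems, g K := by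
  simp only [Finset.sum_filter]
  rw [Finset.sum_comm, Finset.mul_sum]
  refine Finset.sum_le_sum fun K hK => ?_
  rw [← Finset.sum_filter, Finset.sum_const, nsmul_eq_mul]
  refine mul_le_mul_of_nonneg_right ?_ (hg K hK)
  have hsub : {e ∈ T.faces | e ⊆ K} ⊆ K.powersetCard d := fun e he => by
    rw [Finset.mem_filter] at he
    exact Finset.mem_powersetCard.2 ⟨he.2, T.card_of_mem_faces he.1⟩
  have hcard := Finset.card_le_card hsub
  rw [Finset.card_powersetCard, T.card_elem K hK, Nat.choose_succ_self_right] at hcard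
  exact_mod_cast hcard

open scoped Classical in
variable (u) in
theorem norm_avgStrain_sq_le (he : e ∈ T.faces) (x : Pt d) :
    ‖T.avgStrain u e x‖ ^ 2
      ≤ ∑ K ∈ T.elems with e ⊆ K, ‖traction (u K) (normal K e) x‖ ^ 2 := by
  have sum_le (s : Finset (Finset (Pt d))) (hs : ∀ K ∈ s, K ∈ adjacent T.elems e) :
      ∑ K ∈ s, ‖traction (u K) (normal K e) x‖ ^ 2
        ≤ ∑ K ∈ T.elems with e ⊆ K, ‖traction (u K) (normal K e) x‖ ^ 2 :=
    Finset.sum_le_sum_of_subset_of_nonneg (fun K hK => Finset.mem_filter.2 (hs K hK))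
      fun _ _ _ => sq_nonneg _
  unfold avgStrain
  split_ifs with hi
  · obtain ⟨hsnd, hne⟩ := T.snd_mem e he hi
    have pair := sum_le {T.fst e, T.snd e} (by simp [T.fst_mem e he, hsnd])
    rw [Finset.sum_pair hne.symm] at pair
    refine le_trans ?_ pair
    set a := traction (u (T.fst e)) (normal (T.fst e) e) x
    set b := traction (u (T.snd e)) (normal (T.snd e) e) x
    rw [norm_smul, mul_pow, Real.norm_of_nonneg one_half_pos.le]
    linarith [parallelogram_law_with_norm ℝ a b, mul_self_nonneg ‖a + b‖, sq_nonneg ‖a‖,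
      sq_nonneg ‖b‖]
  · simpa using sum_le {T.fst e} (by simp [T.fst_mem e he])

theorem abs_sum_faceIntegral_inner_le (hd : 1 ≤ d) {F G : Finset (Pt d) → Pt d → Pt d}
    (hF : ∀ e, Continuous (F e)) (hG : ∀ e, Continuous (G e)) {a b c : Finset (Pt d) → ℝ}
    (ha : ∀ e, 0 ≤ a e) (hb : ∀ e, 0 ≤ b e) (hc : ∀ e ∈ T.faces, c e ^ 2 ≤ a e * b e) :
    |∑ e ∈ T.faces, faceIntegral e fun x => c e * inner ℝ (F e x) (G e x)|
      ≤ √(∑ e ∈ T.faces, a e * faceIntegral e fun x => ‖F e x‖ ^ 2)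
        * √(∑ e ∈ T.faces, b e * faceIntegral e fun x => ‖G e x‖ ^ 2) := by
  simp only [faceIntegral, ← integral_const_mul]
  refine abs_sum_integral_le_sqrt_mul_sqrt _
    (fun e he => T.integrable_of_mem_faces hd he (by fun_prop))
    (fun e he => T.integrable_of_mem_faces hd he (by fun_prop))
    (fun e _ x => mul_nonneg (ha e) (sq_nonneg _)) (fun e _ x => mul_nonneg (hb e) (sq_nonneg _))
    fun e he x => ?_
  calc (c e * inner ℝ (F e x) (G e x)) ^ 2 = c e ^ 2 * inner ℝ (F e x) (G e x) ^ 2 := mul_pow _ _ _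
    _ ≤ (a e * b e) * (‖F e x‖ * ‖G e x‖) ^ 2 :=
        mul_le_mul (hc e he) (sq_le_sq.2 ((abs_real_inner_le_norm _ _).trans (le_abs_self _)))
          (sq_nonneg _) (mul_nonneg (ha e) (hb e))
    _ = a e * ‖F e x‖ ^ 2 * (b e * ‖G e x‖ ^ 2) := by ring

variable (u w)

theorem abs_sum_integral_strain_le :
    |∑ K ∈ T.elems, ∫ x in hull K, ∑ i, ∑ j, ev (strain (u K) i j) x * ev (strain (w K) i j) x|
      ≤ √(T.gradNormSq u) * √(T.gradNormSq w) :=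
  abs_sum_integral_le_sqrt_mul_sqrt _ (fun _ _ => integrable_hull (by fun_prop))
    (fun _ _ => integrable_hull (by fun_prop)) (fun K _ => gradSq_nonneg (u K))
    (fun K _ => gradSq_nonneg (w K)) fun K _ x =>
      (sum_strain_mul_strain_sq_le (u K) (w K) x).trans (mul_le_mul (strainSq_le_gradSq (u K) x)
        (strainSq_le_gradSq (w K) x) (strainSq_nonneg (w K) x) (gradSq_nonneg (u K) x))

theorem abs_sum_faceIntegral_avgStrain_jumpTang_le (hd : 2 ≤ d) :
    |∑ e ∈ T.faces, faceIntegral e fun x => inner ℝ (T.avgStrain u e x) (T.jumpTang w e x)|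
      ≤ √(T.avgNormSq u) * √(T.jumpNormSq w) := by
  have h (e) (he : e ∈ T.faces) :
      (1 : ℝ) ^ 2 ≤ Metric.diam (hull e) * (Metric.diam (hull e))⁻¹ := by
    rw [mul_inv_cancel₀ (diam_hull_pos (hd.trans_eq (T.card_of_mem_faces he).symm)).ne', one_pow]
  simpa only [one_mul, avgNormSq, jumpNormSq] using T.abs_sum_faceIntegral_inner_le (by omega)
    (T.continuous_avgStrain u) (T.continuous_jumpTang w) (fun _ => Metric.diam_nonneg)
    (fun _ => inv_nonneg.2 Metric.diam_nonneg) h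

theorem abs_sum_faceIntegral_jumpTang_le (hd : 1 ≤ d) (η : ℝ) :
    |∑ e ∈ T.faces, faceIntegral e fun x =>
      η * (Metric.diam (hull e))⁻¹ * inner ℝ (T.jumpTang u e x) (T.jumpTang w e x)|
      ≤ |η| * (√(T.jumpNormSq u) * √(T.jumpNormSq w)) := by
  have h := T.abs_sum_faceIntegral_inner_le hd (T.continuous_jumpTang u) (T.continuous_jumpTang w)
    (a := fun e => (Metric.diam (hull e))⁻¹) (fun _ => inv_nonneg.2 Metric.diam_nonneg)
    (fun _ => inv_nonneg.2 Metric.diam_nonneg) fun e _ => (sq _).le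
  simp only [faceIntegral, integral_const_mul] at h
  simp only [jumpNormSq, faceIntegral, mul_assoc, integral_const_mul, ← Finset.mul_sum, abs_mul]
  exact mul_le_mul_of_nonneg_left h (abs_nonneg η)

end

open scoped Classical in
theorem exists_avgNormSq_le (hd : 1 ≤ d) (l : ℕ) (σ : ℝ) :
    ∃ C : ℝ, 0 ≤ C ∧ ∀ (Ω : Set (Pt d)) (T : Triangulation d Ω), T.ShapeRegular σ →
      ∀ u : VectorField d, T.DegreeLE l u → T.avgNormSq u ≤ C * T.gradNormSq u := by
  obtain ⟨C, hC, trace⟩ := exists_trace_traction_le hd l σ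
  refine ⟨C * (d + 1), by positivity, fun Ω T hT u hu => ?_⟩
  have face_le (e) (he : e ∈ T.faces) :
      Metric.diam (hull e) * faceIntegral e (fun x => ‖T.avgStrain u e x‖ ^ 2)
        ≤ ∑ K ∈ T.elems with e ⊆ K, C * ∫ x in hull K, gradSq (u K) x := by
    have hint {f : Pt d → ℝ} (hf : Continuous f) := T.integrable_of_mem_faces hd he hf
    calc _ ≤ Metric.diam (hull e) * ∫ x in hull e,
          ∑ K ∈ T.elems with e ⊆ K, ‖traction (u K) (normal K e) x‖ ^ 2 ∂μHE[d - 1] :=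
          mul_le_mul_of_nonneg_left (integral_mono (hint (by fun_prop)) (hint (by fun_prop))
            (T.norm_avgStrain_sq_le u he)) Metric.diam_nonneg
      _ = ∑ K ∈ T.elems with e ⊆ K, Metric.diam (hull e) *
          ∫ x in hull e, ‖traction (u K) (normal K e) x‖ ^ 2 ∂μHE[d - 1] := by
          rw [integral_finsetSum _ fun K _ => hint (by fun_prop), Finset.mul_sum]
      _ ≤ ∑ K ∈ T.elems with e ⊆ K, C * ∫ x in hull K, gradSq (u K) x := by
          refine Finset.sum_le_sum fun K hK => ?_
          obtain ⟨hK, heK⟩ := Finset.mem_filter.1 hK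
          exact trace K e (hT K hK) heK (T.affineIndependent_of_mem_faces he)
            (T.card_of_mem_faces he) (u K) (hu K hK)
  calc T.avgNormSq u
      ≤ ∑ e ∈ T.faces, ∑ K ∈ T.elems with e ⊆ K, C * ∫ x in hull K, gradSq (u K) x :=
        Finset.sum_le_sum face_le
    _ ≤ (d + 1) * ∑ K ∈ T.elems, C * ∫ x in hull K, gradSq (u K) x :=
        T.sum_faces_sum_elems_le fun K _ => mul_nonneg hC (integral_nonneg (gradSq_nonneg (u K)))
    _ = C * (d + 1) * T.gradNormSq u := by
        rw [gradNormSq, ← Finset.mul_sum]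
        ring

theorem exists_abs_ah_le (hd : 2 ≤ d) (l : ℕ) (σ η : ℝ) :
    ∃ C : ℝ, 0 ≤ C ∧ ∀ (Ω : Set (Pt d)) (T : Triangulation d Ω), T.ShapeRegular σ →
      ∀ u w : VectorField d, T.DegreeLE l u → T.DegreeLE l w →
        |T.ah η u w| ≤ C * (√(T.dgNormSq u) * √(T.dgNormSq w)) := by
  obtain ⟨C, hC, avg_le⟩ := exists_avgNormSq_le (d := d) (by omega) l σ
  refine ⟨1 + 2 * √C + |η|, by positivity, fun Ω T hT u w hu hw => ?_⟩
  have grad_le (v) : √(T.gradNormSq v) ≤ √(T.dgNormSq v) := Real.sqrt_le_sqrt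
    (by linarith [T.gradNormSq_add_jumpNormSq_le v, T.jumpNormSq_nonneg v])
  have jump_le (v) : √(T.jumpNormSq v) ≤ √(T.dgNormSq v) := Real.sqrt_le_sqrt
    (by linarith [T.gradNormSq_add_jumpNormSq_le v, T.gradNormSq_nonneg v])
  have avg_le (v) (hv : T.DegreeLE l v) : √(T.avgNormSq v) ≤ √C * √(T.dgNormSq v) :=
    calc √(T.avgNormSq v) ≤ √C * √(T.gradNormSq v) := by
          rw [← Real.sqrt_mul hC]
          exact Real.sqrt_le_sqrt (avg_le Ω T hT v hv)
      _ ≤ √C * √(T.dgNormSq v) :=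
          mul_le_mul_of_nonneg_left (grad_le v) (Real.sqrt_nonneg C)
  have strain := abs_le.1 ((T.abs_sum_integral_strain_le u w).trans
    (mul_le_mul (grad_le u) (grad_le w) (Real.sqrt_nonneg _) (Real.sqrt_nonneg _)))
  have consistency := abs_le.1 ((T.abs_sum_faceIntegral_avgStrain_jumpTang_le u w hd).trans
    (mul_le_mul (avg_le u hu) (jump_le w) (Real.sqrt_nonneg _) (by positivity)))
  have symmetry := abs_le.1 ((T.abs_sum_faceIntegral_avgStrain_jumpTang_le w u hd).trans
    (mul_le_mul (avg_le w hw) (jump_le u) (Real.sqrt_nonneg _) (by positivity)))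
  have penalty := abs_le.1 ((T.abs_sum_faceIntegral_jumpTang_le u w (by omega) η).trans
    (mul_le_mul_of_nonneg_left (mul_le_mul (jump_le u) (jump_le w) (Real.sqrt_nonneg _)
      (Real.sqrt_nonneg _)) (abs_nonneg η)))
  rw [ah, abs_le]
  constructor <;> linarith

end Triangulation

/-! ### Weak divergences -/

section WeakDivergence

variable {U Ω : Set (Pt d)} {f f' : Pt d → Pt d} {g g' φ : Pt d → ℝ}

theorem setIntegral_mul_eq_integral (hφ : tsupport φ ⊆ U) :
    ∫ x in U, g x * φ x = ∫ x, g x * φ x :=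
  setIntegral_eq_integral_of_forall_compl_eq_zero fun x hx => by
    rw [image_eq_zero_of_notMem_tsupport fun h => hx (hφ h), mul_zero]

theorem setIntegral_fderiv_apply_eq_integral (hφ : tsupport φ ⊆ U) :
    ∫ x in U, fderiv ℝ φ x (f x) = ∫ x, fderiv ℝ φ x (f x) :=
  setIntegral_eq_integral_of_forall_compl_eq_zero fun x hx => by
    rw [Function.notMem_support.1 fun h => hx (hφ (support_fderiv_subset ℝ h)),
      _root_.zero_apply]

theorem isWeakDiv_iff_integral : IsWeakDiv U f g ↔ ∀ φ : Pt d → ℝ, ContDiff ℝ ∞ φ →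
    HasCompactSupport φ → tsupport φ ⊆ U → ∫ x, fderiv ℝ φ x (f x) = - ∫ x, g x * φ x :=
  forall₄_congr fun φ _ _ hs => by
    rw [setIntegral_mul_eq_integral hs, setIntegral_fderiv_apply_eq_integral hs]

theorem IsWeakDiv.mono (h : IsWeakDiv Ω f g) (hU : U ⊆ Ω) : IsWeakDiv U f g :=
  isWeakDiv_iff_integral.2 fun φ hφ hc hs => isWeakDiv_iff_integral.1 h φ hφ hc (hs.trans hU)

theorem IsWeakDiv.congr (h : IsWeakDiv U f g) (hU : MeasurableSet U) (hf : Set.EqOn f f' U) :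
    IsWeakDiv U f' g := fun φ hφ hc hs => by
  rw [← h φ hφ hc hs]
  exact setIntegral_congr_fun hU fun x hx => by rw [hf hx]

theorem IsWeakDiv.ae_eq (h : IsWeakDiv U f g) (h' : IsWeakDiv U f g') (hU : IsOpen U)
    (hg : IntegrableOn g U) (hg' : IntegrableOn g' U) : g =ᵐ[volume.restrict U] g' := by
  have hi := hg.sub hg'
  have hae := hU.ae_eq_zero_of_integral_contDiff_smul_eq_zero hi.locallyIntegrableOn
    fun φ hφ hc hs => ?_
  · filter_upwards [(ae_restrict_iff' hU.measurableSet).2 hae] with x hx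
    exact sub_eq_zero.1 hx
  obtain ⟨B, hB⟩ := hc.exists_bound_of_continuous hφ.continuous
  have integrable_mul {k : Pt d → ℝ} (hk : Integrable k (volume.restrict U)) :
      Integrable (fun x => k x * φ x) (volume.restrict U) :=
    hk.mul_bdd hφ.continuous.aestronglyMeasurable (Filter.Eventually.of_forall hB)
  calc ∫ x, φ x • (g - g') x = ∫ x in U, (g - g') x * φ x := by
        simp only [setIntegral_mul_eq_integral hs, smul_eq_mul, mul_comm (φ _)]
    _ = (∫ x in U, g x * φ x) - ∫ x in U, g' x * φ x := by
        simp only [Pi.sub_apply, sub_mul]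
        exact integral_sub (integrable_mul hg) (integrable_mul hg')
    _ = 0 := by rw [← neg_inj.1 ((h φ hφ hc hs).symm.trans (h' φ hφ hc hs)), sub_self]

theorem isWeakDiv_weakDiv (hf : MemHDiv Ω f) : IsWeakDiv Ω f (weakDiv Ω f) := by
  rw [weakDiv, dif_pos hf]
  exact hf.2.choose_spec.2

theorem memLp_weakDiv (hf : MemHDiv Ω f) : MemLp (weakDiv Ω f) 2 (volume.restrict Ω) := by
  rw [weakDiv, dif_pos hf]
  exact hf.2.choose_spec.1

end WeakDivergence

section PolynomialDivergence

theorem hasFDerivAt_ev (p : MvPolynomial (Fin d) ℝ) (x : Pt d) :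
    HasFDerivAt (ev p) (∑ i, ev (MvPolynomial.pderiv i p) x •
      (EuclideanSpace.proj i : Pt d →L[ℝ] ℝ)) x := by
  induction p using MvPolynomial.induction_on with
  | C a =>
    have : ev (MvPolynomial.C a) = fun _ : Pt d => a := by funext y; simp [ev]
    rw [this]
    exact (hasFDerivAt_const a x).congr_fderiv (by simp [ev])
  | add p q hp hq =>
    have : ev (p + q) = ev p + ev q := by funext y; simp [ev]
    rw [this]
    exact (hp.add hq).congr_fderiv (by simp [ev, add_smul, Finset.sum_add_distrib])
  | mul_X p j hp =>
    have : ev (p * MvPolynomial.X j) = ev p * fun y : Pt d => y j := by funext y; simp [ev]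
    rw [this]
    refine (hp.mul (EuclideanSpace.proj j : Pt d →L[ℝ] ℝ).hasFDerivAt).congr_fderiv ?_
    ext v
    simp [ev, Derivation.leibniz, MvPolynomial.pderiv_X, Pi.single_apply, apply_ite, add_mul,
      mul_assoc, Finset.sum_add_distrib, Finset.mul_sum]

theorem fderiv_ev_single (p : MvPolynomial (Fin d) ℝ) (x : Pt d) (i : Fin d) :
    fderiv ℝ (ev p) x (EuclideanSpace.single i 1) = ev (MvPolynomial.pderiv i p) x := by
  rw [(hasFDerivAt_ev p x).fderiv]
  simp

variable (u : Fin d → MvPolynomial (Fin d) ℝ)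

/-- The divergence of a polynomial vector field. -/
noncomputable def divPoly : MvPolynomial (Fin d) ℝ := ∑ i, MvPolynomial.pderiv i (u i)

theorem ev_divPoly (x : Pt d) : ev (divPoly u) x = ∑ i, ev (MvPolynomial.pderiv i (u i)) x :=
  map_sum (MvPolynomial.eval fun i => x i) _ _

theorem ev_divPoly_sq_le (x : Pt d) : ev (divPoly u) x ^ 2 ≤ d * gradSq u x := by
  calc ev (divPoly u) x ^ 2 ≤ d * ∑ i, ev (MvPolynomial.pderiv i (u i)) x ^ 2 := by
        rw [ev_divPoly]
        exact sq_sum_le_card_mul_sum_sq.trans_eq (by rw [Finset.card_univ, Fintype.card_fin])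
    _ ≤ d * gradSq u x := mul_le_mul_of_nonneg_left (Finset.sum_le_sum fun i _ =>
        Finset.single_le_sum (f := fun j => ev (MvPolynomial.pderiv j (u i)) x ^ 2)
          (fun _ _ => sq_nonneg _) (Finset.mem_univ i)) (Nat.cast_nonneg d)

theorem apply_evV (L : Pt d →L[ℝ] ℝ) (x : Pt d) :
    L (evV u x) = ∑ i, ev (u i) x * L (EuclideanSpace.single i 1) := by
  have : evV u x = ∑ i, ev (u i) x • EuclideanSpace.single i (1 : ℝ) := by
    ext j
    simp [evV, Pi.single_apply]
  rw [this, map_sum]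
  simp only [map_smul, smul_eq_mul]

theorem isWeakDiv_evV (U : Set (Pt d)) : IsWeakDiv U (evV u) (ev (divPoly u)) := by
  refine isWeakDiv_iff_integral.2 fun φ hφ hc _ => ?_
  have hφc := hφ.continuous
  have hdφ (v : Pt d) : Continuous fun x => fderiv ℝ φ x v :=
    (hφ.continuous_fderiv (by simp)).clm_apply continuous_const
  have integrable_mul (p) : Integrable fun x => ev p x * φ x :=
    Continuous.integrable_of_hasCompactSupport (by fun_prop) hc.mul_left
  have integrable_mul_fderiv (p v) : Integrable fun x => ev p x * fderiv ℝ φ x v :=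
    Continuous.integrable_of_hasCompactSupport (by fun_prop) (hc.fderiv_apply ℝ v).mul_left
  simp only [apply_evV, ev_divPoly, Finset.sum_mul]
  rw [integral_finsetSum _ fun i _ => integrable_mul_fderiv _ _,
    integral_finsetSum _ fun i _ => integrable_mul _, ← Finset.sum_neg_distrib]
  refine Finset.sum_congr rfl fun i _ => ?_
  simp only [← fderiv_ev_single]
  exact integral_mul_fderiv_eq_neg_fderiv_mul_of_integrable
    (by simpa only [fderiv_ev_single] using integrable_mul _) (integrable_mul_fderiv _ _)
    (integrable_mul _) (fun x _ => (hasFDerivAt_ev _ x).differentiableAt)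
    fun x _ => hφ.differentiable (by simp) x

end PolynomialDivergence

namespace Triangulation

variable {Ω : Set (Pt d)} (T : Triangulation d Ω)

include T in
theorem isOpen_domain : IsOpen Ω := T.cover ▸ isOpen_interior

theorem domain_subset_iUnion_hull : Ω ⊆ ⋃ K ∈ T.elems, hull K :=
  T.cover.symm.subset.trans interior_subset

include T in
theorem isBounded_domain : Bornology.IsBounded Ω :=
  (T.elems.finite_toSet.isCompact_biUnion fun K _ => isCompact_hull K).isBounded.subset
    T.domain_subset_iUnion_hull

include T in
theorem memLp_of_continuous {E : Type*} [NormedAddCommGroup E] {f : Pt d → E} (hf : Continuous f)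
    (p : ENNReal) : MemLp f p (volume.restrict Ω) :=
  memLp_restrict_of_continuous T.isBounded_domain T.isOpen_domain.measurableSet
    T.isBounded_domain.measure_lt_top hf p

theorem memLp_glue (q : ScalarField d) : MemLp (T.glue q) 2 (volume.restrict Ω) :=
  memLp_finsetSum _ fun _ _ =>
    (T.memLp_of_continuous (continuous_ev _) 2).indicator isOpen_interior.measurableSet

variable {K L : Finset (Pt d)}

theorem interior_hull_subset_domain (hK : K ∈ T.elems) : interior (hull K) ⊆ Ω :=
  (interior_mono (Set.subset_biUnion_of_mem (u := fun K => hull K) hK)).trans T.cover.subset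

theorem disjoint_interior_hull (hK : K ∈ T.elems) (hL : L ∈ T.elems) (hKL : K ≠ L) :
    Disjoint (interior (hull K)) (interior (hull L)) := by
  rw [Set.disjoint_iff_inter_eq_empty, ← Set.not_nonempty_iff_eq_empty, ← interior_inter]
  intro hne
  have hspan := interior_convexHull_nonempty_iff_affineSpan_eq_top.1
    (hne.mono (interior_mono (T.inter K hK L hL)))
  obtain ⟨p, hpK, hpL⟩ : ∃ p ∈ K, p ∉ L := by
    by_contra! h
    exact hKL (Finset.eq_of_subset_of_card_le h (by rw [T.card_elem K hK, T.card_elem L hL]))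
  have hsub : (K : Set (Pt d)) ∩ L ⊆ ((↑) : K → Pt d) '' (Set.univ \ {⟨p, hpK⟩}) := by
    rintro x ⟨hxK, hxL⟩
    exact ⟨⟨x, hxK⟩, ⟨trivial, fun h => hpL ((congrArg Subtype.val h).subst hxL)⟩, rfl⟩
  exact (T.indep K hK).notMem_affineSpan_sdiff ⟨p, hpK⟩ Set.univ
    (affineSpan_mono ℝ hsub (hspan ▸ AffineSubspace.mem_top ℝ _ _))

theorem glueV_eqOn (u : VectorField d) (hK : K ∈ T.elems) :
    Set.EqOn (T.glueV u) (evV (u K)) (interior (hull K)) := fun x hx => by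
  rw [glueV, Finset.sum_eq_single_of_mem K hK, Set.indicator_of_mem hx]
  exact fun L hL hLK => Set.indicator_of_notMem
    (fun h => Set.disjoint_left.1 (T.disjoint_interior_hull hL hK hLK) h hx) _

theorem domain_ae_eq_iUnion_interior_hull :
    Ω =ᵐ[volume] (⋃ K ∈ T.elems, interior (hull K) : Set (Pt d)) := by
  have subset_frontiers :
      Ω \ ⋃ K ∈ T.elems, interior (hull K) ⊆ ⋃ K ∈ T.elems, frontier (hull K) := fun x hx => by
    obtain ⟨K, hK, hxK⟩ := Set.mem_iUnion₂.1 (T.domain_subset_iUnion_hull hx.1)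
    exact Set.mem_biUnion hK ⟨subset_closure hxK, fun hi => hx.2 (Set.mem_biUnion hK hi)⟩
  have frontiers_null : volume (⋃ K ∈ T.elems, frontier (hull K)) = 0 :=
    (measure_biUnion_null_iff T.elems.countable_toSet).2 fun K _ =>
      (convex_convexHull ℝ _).addHaar_frontier _
  have interiors_subset : ⋃ K ∈ T.elems, interior (hull K) ⊆ Ω :=
    Set.iUnion₂_subset fun _ hK => T.interior_hull_subset_domain hK
  refine ae_eq_set.2 ⟨measure_mono_null subset_frontiers frontiers_null, ?_⟩
  rw [Set.sdiff_eq_empty.2 interiors_subset, measure_empty]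

theorem setIntegral_domain_eq_sum {f : Pt d → ℝ} (hf : IntegrableOn f Ω) :
    ∫ x in Ω, f x = ∑ K ∈ T.elems, ∫ x in interior (hull K), f x := by
  rw [setIntegral_congr_set T.domain_ae_eq_iUnion_interior_hull]
  exact integral_biUnion_finset _ (fun _ _ => isOpen_interior.measurableSet)
    (fun _ hK _ hL h => T.disjoint_interior_hull hK hL h)
    fun _ hK => hf.mono_set (T.interior_hull_subset_domain hK)

variable {T} {u : VectorField d}

theorem memLp_div (hu : MemHDiv Ω (T.glueV u)) : MemLp (T.div u) 2 (volume.restrict Ω) :=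
  memLp_weakDiv hu

theorem div_ae_eq (hu : MemHDiv Ω (T.glueV u)) (hK : K ∈ T.elems) :
    T.div u =ᵐ[volume.restrict (interior (hull K))] ev (divPoly (u K)) := by
  have : IsFiniteMeasure (volume.restrict Ω) := ⟨by simpa using T.isBounded_domain.measure_lt_top⟩
  have hKΩ := T.interior_hull_subset_domain hK
  have hw : IsWeakDiv (interior (hull K)) (evV (u K)) (T.div u) :=
    ((isWeakDiv_weakDiv hu).mono hKΩ).congr isOpen_interior.measurableSet (T.glueV_eqOn u hK)
  have hdiv : IntegrableOn (T.div u) Ω := (memLp_div hu).integrable (by norm_num)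
  exact hw.ae_eq (isWeakDiv_evV (u K) _) isOpen_interior (hdiv.mono_set hKΩ)
    (IntegrableOn.mono_set (integrable_hull (continuous_ev _)) interior_subset)

theorem integral_div_sq_le (hu : MemHDiv Ω (T.glueV u)) :
    ∫ x in Ω, T.div u x ^ 2 ≤ d * T.gradNormSq u := by
  rw [T.setIntegral_domain_eq_sum (memLp_div hu).integrable_sq, gradNormSq, Finset.mul_sum]
  refine Finset.sum_le_sum fun K hK => ?_
  have hint {f : Pt d → ℝ} (hf : Continuous f) : IntegrableOn f (hull K) := integrable_hull hf
  calc ∫ x in interior (hull K), T.div u x ^ 2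
      = ∫ x in interior (hull K), ev (divPoly (u K)) x ^ 2 :=
        integral_congr_ae ((div_ae_eq hu hK).fun_comp (· ^ 2))
    _ ≤ ∫ x in hull K, ev (divPoly (u K)) x ^ 2 :=
        setIntegral_mono_set (hint (by fun_prop)) (Filter.Eventually.of_forall fun _ => sq_nonneg _)
          interior_subset.eventuallyLE
    _ ≤ ∫ x in hull K, d * gradSq (u K) x :=
        integral_mono (hint (by fun_prop)) (hint (by fun_prop)) (ev_divPoly_sq_le (u K))
    _ = d * ∫ x in hull K, gradSq (u K) x := integral_const_mul _ _

end Triangulation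

/-! ### The matrix `Λ` -/

section WeightedLaplacian

variable {ι : Type*} [Fintype ι] [DecidableEq ι] {b : ι → ι → ℝ}

/-- The Laplacian of a graph on `ι` with edge weights `b`. -/
def weightedLaplacian (b : ι → ι → ℝ) : Matrix ι ι ℝ :=
  diagonal (fun i => ∑ j, b i j) - of b

theorem weightedLaplacian_mulVec_dotProduct (hb : ∀ i j, b i j = b j i) (x : ι → ℝ) :
    weightedLaplacian b *ᵥ x ⬝ᵥ x = (∑ i, ∑ j, b i j * (x i - x j) ^ 2) / 2 := by
  have swap : ∑ i, ∑ j, b i j * x i ^ 2 = ∑ i, ∑ j, b i j * x j ^ 2 := by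
    rw [Finset.sum_comm]
    simp only [hb]
  have expand : weightedLaplacian b *ᵥ x ⬝ᵥ x
      = ∑ i, ∑ j, b i j * x i ^ 2 - ∑ i, ∑ j, b i j * (x i * x j) := by
    rw [weightedLaplacian, sub_mulVec, sub_dotProduct]
    simp only [dotProduct, mulVec_diagonal]
    simp only [mulVec, dotProduct, of_apply, Finset.sum_mul]
    congr 1 <;> exact Finset.sum_congr rfl fun i _ => Finset.sum_congr rfl fun j _ => by ring
  have square : ∑ i, ∑ j, b i j * (x i - x j) ^ 2
      = ∑ i, ∑ j, b i j * x i ^ 2 - 2 * ∑ i, ∑ j, b i j * (x i * x j)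
        + ∑ i, ∑ j, b i j * x j ^ 2 := by
    simp only [Finset.mul_sum, ← Finset.sum_sub_distrib, ← Finset.sum_add_distrib]
    exact Finset.sum_congr rfl fun i _ => Finset.sum_congr rfl fun j _ => by ring
  rw [expand, square]
  linarith

theorem posSemidef_weightedLaplacian (hb : ∀ i j, b i j = b j i) (hb0 : ∀ i j, 0 ≤ b i j) :
    (weightedLaplacian b).PosSemidef := by
  refine .of_dotProduct_mulVec_nonneg ?_ fun x => ?_
  · exact (isHermitian_diagonal _).sub (Matrix.ext fun i j => by simp [hb i j])
  · rw [star_trivial, dotProduct_comm, weightedLaplacian_mulVec_dotProduct hb]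
    exact div_nonneg (Finset.sum_nonneg fun i _ => Finset.sum_nonneg fun j _ =>
      mul_nonneg (hb0 i j) (sq_nonneg _)) zero_le_two

end WeightedLaplacian

namespace Params

variable {n : ℕ} (M : Params n)

theorem lam0_pos : 0 < M.lam0 := one_pos.trans_le (le_max_left _ _)

theorem Rinv_pos (i : Fin n) : 0 < M.Rinv i :=
  mul_pos (mul_pos (inv_pos.2 M.tau_pos) (inv_pos.2 (M.K_pos i))) (pow_pos (M.alpha_pos i) 2)

theorem RinvMax_pos [NeZero n] : 0 < M.RinvMax :=
  (M.Rinv_pos 0).trans_le (Finset.le_sup' M.Rinv (Finset.mem_univ 0))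

theorem Lambda1_eq : M.Lambda1 = diagonal (fun i => (M.alpha i)⁻¹)
    * weightedLaplacian (fun i j => M.tau * M.beta i j) * diagonal fun i => (M.alpha i)⁻¹ := by
  ext i j
  rw [mul_diagonal, diagonal_mul]
  rcases eq_or_ne i j with rfl | hij
  · simp only [Lambda1, of_apply, if_true, alphaNet, betaFull, weightedLaplacian,
      Matrix.sub_apply, diagonal_apply_eq, ← Finset.mul_sum,
      ← Finset.add_sum_erase _ _ (Finset.mem_univ i)]
    field_simp
    ring
  · simp only [Lambda1, of_apply, if_neg hij, alphaNet, betaFull, weightedLaplacian,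
      Matrix.sub_apply, diagonal_apply_ne _ hij]
    field_simp
    ring

theorem posSemidef_Lambda1 : M.Lambda1.PosSemidef := by
  have hL : (weightedLaplacian fun i j => M.tau * M.beta i j).PosSemidef :=
    posSemidef_weightedLaplacian (fun i j => by rw [M.beta_symm])
      fun i j => mul_nonneg M.tau_pos.le (M.beta_nonneg i j)
  simpa [Lambda1_eq] using hL.conjTranspose_mul_mul_same (diagonal fun i => (M.alpha i)⁻¹)

theorem posSemidef_Lambda2 : M.Lambda2.PosSemidef :=
  .diagonal fun i => div_nonneg (M.c_nonneg i) (sq_nonneg _)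

theorem posDef_Lambda3 [NeZero n] : M.Lambda3.PosDef :=
  .diagonal fun _ => inv_pos.2 M.RinvMax_pos

theorem Lambda4_mulVec_dotProduct (x : Fin n → ℝ) :
    M.Lambda4 *ᵥ x ⬝ᵥ x = M.lam0⁻¹ * (∑ i, x i) ^ 2 := by
  simp only [Lambda4, mulVec, dotProduct, of_apply, ← Finset.mul_sum]
  ring

theorem posSemidef_Lambda4 : M.Lambda4.PosSemidef := by
  refine .of_dotProduct_mulVec_nonneg (Matrix.ext fun _ _ => rfl) fun x => ?_
  rw [star_trivial, dotProduct_comm, Lambda4_mulVec_dotProduct]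
  exact mul_nonneg (inv_nonneg.2 M.lam0_pos.le) (sq_nonneg _)

variable [NeZero n]

theorem posDef_Lambda : M.Lambda.PosDef :=
  (M.posDef_Lambda3.posSemidef_add
    (M.posSemidef_Lambda1.add M.posSemidef_Lambda2)).add_posSemidef M.posSemidef_Lambda4

theorem Lambda1_add_Lambda2_mulVec_dotProduct_le (x : Fin n → ℝ) :
    (M.Lambda1 + M.Lambda2) *ᵥ x ⬝ᵥ x ≤ M.Lambda *ᵥ x ⬝ᵥ x := by
  rw [Lambda, add_assoc (M.Lambda1 + M.Lambda2), add_mulVec _ (M.Lambda3 + M.Lambda4),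
    add_dotProduct]
  exact le_add_of_nonneg_right (mulVec_dotProduct_self_nonneg
    (M.posDef_Lambda3.posSemidef.add M.posSemidef_Lambda4) x)

theorem sq_sum_le_lam0_mul (x : Fin n → ℝ) :
    (∑ i, x i) ^ 2 ≤ M.lam0 * (M.Lambda *ᵥ x ⬝ᵥ x) := by
  rw [← inv_mul_le_iff₀ M.lam0_pos, ← Lambda4_mulVec_dotProduct, Lambda, add_mulVec _ M.Lambda4,
    add_dotProduct]
  exact le_add_of_nonneg_left (mulVec_dotProduct_self_nonneg
    ((M.posSemidef_Lambda1.add M.posSemidef_Lambda2).add M.posDef_Lambda3.posSemidef) x)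

end Params

/-! ### Boundedness of the individual terms of `𝒜_h` -/

theorem integrable_mulVec_dotProduct {ι α : Type*} [Fintype ι] [MeasurableSpace α] {μ : Measure α}
    (B : Matrix ι ι ℝ) {f g : ι → α → ℝ} (hf : ∀ i, MemLp (f i) 2 μ) (hg : ∀ i, MemLp (g i) 2 μ) :
    Integrable (fun x => (B *ᵥ fun i => f i x) ⬝ᵥ fun i => g i x) μ := by
  simp only [mulVec, dotProduct, Finset.sum_mul, mul_assoc]
  exact integrable_finsetSum _ fun i _ => integrable_finsetSum _ fun j _ =>
    ((hf j).integrable_mul (hg i)).const_mul (B i j)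

namespace Triangulation

variable {Ω : Set (Pt d)} (T : Triangulation d Ω) {n : ℕ} (M : Params n)

theorem normU_nonneg (u : VectorField d) : 0 ≤ T.normU M u := Real.sqrt_nonneg _

theorem normV_nonneg [NeZero n] (v : Fin n → VectorField d) : 0 ≤ T.normV M v := Real.sqrt_nonneg _

theorem normP_nonneg [NeZero n] (p : Fin n → ScalarField d) : 0 ≤ T.normP M p := Real.sqrt_nonneg _

theorem dgNormSq_nonneg (u : VectorField d) : 0 ≤ T.dgNormSq u :=
  (add_nonneg (T.gradNormSq_nonneg u) (T.jumpNormSq_nonneg u)).trans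
    (T.gradNormSq_add_jumpNormSq_le u)

theorem integral_div_sq_nonneg (u : VectorField d) : 0 ≤ ∫ x in Ω, T.div u x ^ 2 :=
  integral_nonneg fun _ => sq_nonneg _

theorem sqrt_dgNormSq_le_normU (u : VectorField d) : √(T.dgNormSq u) ≤ T.normU M u :=
  Real.sqrt_le_sqrt (le_add_of_nonneg_right (mul_nonneg M.lam_pos.le (T.integral_div_sq_nonneg u)))

theorem sqrt_integral_lam_mul_div_sq_le_normU (u : VectorField d) :
    √(∫ x in Ω, M.lam * T.div u x ^ 2) ≤ T.normU M u := by
  rw [integral_const_mul]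
  exact Real.sqrt_le_sqrt (le_add_of_nonneg_left (T.dgNormSq_nonneg u))

theorem sqrt_integral_lam0_mul_div_sq_le {u : VectorField d} (hu : MemHDiv Ω (T.glueV u)) :
    √(∫ x in Ω, M.lam0 * T.div u x ^ 2) ≤ √(d + 1) * T.normU M u := by
  rw [integral_const_mul, normU, ← Real.sqrt_mul (by positivity)]
  refine Real.sqrt_le_sqrt ?_
  set I := ∫ x in Ω, T.div u x ^ 2
  have hI : 0 ≤ I := T.integral_div_sq_nonneg u
  have lam0_le : M.lam0 ≤ 1 + M.lam :=
    max_le (le_add_of_nonneg_right M.lam_pos.le) (le_add_of_nonneg_left zero_le_one)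
  have grad_le : T.gradNormSq u ≤ T.dgNormSq u :=
    (le_add_of_nonneg_right (T.jumpNormSq_nonneg u)).trans (T.gradNormSq_add_jumpNormSq_le u)
  calc M.lam0 * I ≤ (1 + M.lam) * I := by gcongr
    _ = I + M.lam * I := by ring
    _ ≤ d * T.dgNormSq u + M.lam * I := by
        gcongr
        exact (integral_div_sq_le hu).trans (by gcongr)
    _ ≤ d * T.dgNormSq u + M.lam * I + (T.dgNormSq u + d * (M.lam * I)) :=
        le_add_of_nonneg_right (add_nonneg (T.dgNormSq_nonneg u)
          (mul_nonneg d.cast_nonneg (mul_nonneg M.lam_pos.le hI)))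
    _ = (d + 1) * (T.dgNormSq u + M.lam * I) := by ring

theorem integrable_glue_mul (q : ScalarField d) {f : Pt d → ℝ}
    (hf : MemLp f 2 (volume.restrict Ω)) :
    Integrable (fun x => T.glue q x * f x) (volume.restrict Ω) :=
  (T.memLp_glue q).integrable_mul hf

variable {M} {u w : VectorField d} {v z : Fin n → VectorField d}

theorem abs_lam_mul_integral_div_mul_div_le (hu : MemHDiv Ω (T.glueV u))
    (hw : MemHDiv Ω (T.glueV w)) :
    |M.lam * ∫ x in Ω, T.div u x * T.div w x| ≤ T.normU M u * T.normU M w := by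
  have lam_mul_sq_nonneg (u : VectorField d) (x : Pt d) : 0 ≤ M.lam * T.div u x ^ 2 :=
    mul_nonneg M.lam_pos.le (sq_nonneg _)
  rw [← integral_const_mul]
  calc |∫ x in Ω, M.lam * (T.div u x * T.div w x)|
      ≤ √(∫ x in Ω, M.lam * T.div u x ^ 2) * √(∫ x in Ω, M.lam * T.div w x ^ 2) :=
        abs_integral_le_sqrt_mul_sqrt ((memLp_div hu).integrable_sq.const_mul _)
          ((memLp_div hw).integrable_sq.const_mul _) (lam_mul_sq_nonneg u) (lam_mul_sq_nonneg w)
          fun x => le_of_eq (by ring)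
    _ ≤ T.normU M u * T.normU M w :=
        mul_le_mul (T.sqrt_integral_lam_mul_div_sq_le_normU M u)
          (T.sqrt_integral_lam_mul_div_sq_le_normU M w) (Real.sqrt_nonneg _) (T.normU_nonneg M u)

theorem pressure_term_eq (p q : Fin n → ScalarField d) :
    (∑ i, (-M.alphaP i - M.alphaNet i i) * ∫ x in Ω, T.glue (p i) x * T.glue (q i) x)
      + ∑ i, ∑ j ∈ Finset.univ.erase i,
        M.alphaNet i j * ∫ x in Ω, T.glue (p j) x * T.glue (q i) x
      = - ∫ x in Ω, ((M.Lambda1 + M.Lambda2) *ᵥ fun i => T.glue (p i) x) ⬝ᵥ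
          fun i => T.glue (q i) x := by
  have hint (i j : Fin n) : Integrable (fun x => (M.Lambda1 + M.Lambda2) i j *
      (T.glue (p j) x * T.glue (q i) x)) (volume.restrict Ω) :=
    (T.integrable_glue_mul (p j) (T.memLp_glue (q i))).const_mul _
  have diag (i : Fin n) : (M.Lambda1 + M.Lambda2) i i = -(-M.alphaP i - M.alphaNet i i) := by
    simp only [Params.Lambda1, Params.Lambda2, Matrix.add_apply, Matrix.of_apply, if_true,
      Matrix.diagonal_apply_eq]
    ring
  have offDiag {i j : Fin n} (hij : i ≠ j) : (M.Lambda1 + M.Lambda2) i j = -M.alphaNet i j := by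
    simp only [Params.Lambda1, Params.Lambda2, Matrix.add_apply, Matrix.of_apply, if_neg hij,
      Matrix.diagonal_apply_ne _ hij, add_zero]
  simp only [mulVec, dotProduct, Finset.sum_mul, mul_assoc]
  rw [integral_finsetSum _ fun i _ => integrable_finsetSum _ fun j _ => hint i j,
    ← Finset.sum_neg_distrib, ← Finset.sum_add_distrib]
  refine Finset.sum_congr rfl fun i _ => ?_
  rw [integral_finsetSum _ fun j _ => hint i j, ← Finset.add_sum_erase _ _ (Finset.mem_univ i),
    neg_add, ← Finset.sum_neg_distrib, integral_const_mul, diag, neg_mul, neg_neg]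
  refine congrArg _ (Finset.sum_congr rfl fun j hj => ?_)
  rw [integral_const_mul, offDiag (Finset.ne_of_mem_erase hj).symm, neg_mul, neg_neg]

variable [NeZero n]

theorem integrable_Lambda_mulVec_dotProduct (p : Fin n → ScalarField d) :
    Integrable (fun x => (M.Lambda *ᵥ fun i => T.glue (p i) x) ⬝ᵥ fun i => T.glue (p i) x)
      (volume.restrict Ω) :=
  integrable_mulVec_dotProduct M.Lambda (fun i => T.memLp_glue (p i)) fun i => T.memLp_glue (p i)

theorem abs_sum_integral_glue_mul_div_le_normU (p : Fin n → ScalarField d)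
    (hw : MemHDiv Ω (T.glueV w)) :
    |∑ i, ∫ x in Ω, T.glue (p i) x * T.div w x| ≤ √(d + 1) * (T.normP M p * T.normU M w) := by
  have hdiv := memLp_div hw
  rw [← integral_finsetSum _ fun i _ => T.integrable_glue_mul (p i) hdiv]
  calc |∫ x in Ω, ∑ i, T.glue (p i) x * T.div w x|
      ≤ T.normP M p * √(∫ x in Ω, M.lam0 * T.div w x ^ 2) := by
        refine abs_integral_le_sqrt_mul_sqrt (T.integrable_Lambda_mulVec_dotProduct p)
          (hdiv.integrable_sq.const_mul _)
          (fun x => mulVec_dotProduct_self_nonneg M.posDef_Lambda.posSemidef _)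
          (fun x => mul_nonneg M.lam0_pos.le (sq_nonneg _)) fun x => ?_
        rw [← Finset.sum_mul, mul_pow, mul_left_comm, ← mul_assoc]
        exact mul_le_mul_of_nonneg_right (M.sq_sum_le_lam0_mul _) (sq_nonneg _)
    _ ≤ T.normP M p * (√(d + 1) * T.normU M w) :=
        mul_le_mul_of_nonneg_left (T.sqrt_integral_lam0_mul_div_sq_le M hw) (T.normP_nonneg M p)
    _ = √(d + 1) * (T.normP M p * T.normU M w) := by ring

theorem sqrt_sum_integral_flux_le_normV (v : Fin n → VectorField d) :
    √(∑ i, ∫ x in Ω, M.Rinv i * inner ℝ (T.glueV (v i) x) (T.glueV (v i) x)) ≤ T.normV M v :=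
  Real.sqrt_le_sqrt (le_add_of_nonneg_right
    (integral_nonneg fun _ => mulVec_dotProduct_self_nonneg M.posDef_Lambda.inv.posSemidef _))

theorem sqrt_integral_Lambda_inv_div_le_normV (v : Fin n → VectorField d) :
    √(∫ x in Ω, (M.Lambda⁻¹ *ᵥ fun i => T.div (v i) x) ⬝ᵥ fun i => T.div (v i) x)
      ≤ T.normV M v :=
  Real.sqrt_le_sqrt (le_add_of_nonneg_left (Finset.sum_nonneg fun i _ => integral_nonneg fun _ =>
    mul_nonneg (M.Rinv_pos i).le real_inner_self_nonneg))

theorem abs_sum_integral_flux_le (hv : ∀ i, MemHDiv Ω (T.glueV (v i)))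
    (hz : ∀ i, MemHDiv Ω (T.glueV (z i))) :
    |∑ i, ∫ x in Ω, M.Rinv i * inner ℝ (T.glueV (v i) x) (T.glueV (z i) x)|
      ≤ T.normV M v * T.normV M z := by
  have flux_nonneg (v : Fin n → VectorField d) (i : Fin n) (x : Pt d) :
      0 ≤ M.Rinv i * inner ℝ (T.glueV (v i) x) (T.glueV (v i) x) :=
    mul_nonneg (M.Rinv_pos i).le real_inner_self_nonneg
  have flux_integrable {v : Fin n → VectorField d} (hv : ∀ i, MemHDiv Ω (T.glueV (v i)))
      (i : Fin n) : Integrable (fun x => M.Rinv i * inner ℝ (T.glueV (v i) x) (T.glueV (v i) x))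
        (volume.restrict Ω) := by
    simp only [real_inner_self_eq_norm_sq]
    exact (hv i).1.norm.integrable_sq.const_mul _
  refine (abs_sum_integral_le_sqrt_mul_sqrt Finset.univ (fun i _ => flux_integrable hv i)
    (fun i _ => flux_integrable hz i) (fun i _ => flux_nonneg v i) (fun i _ => flux_nonneg z i)
    fun i _ x => ?_).trans (mul_le_mul (T.sqrt_sum_integral_flux_le_normV v)
      (T.sqrt_sum_integral_flux_le_normV z) (Real.sqrt_nonneg _) (T.normV_nonneg M v))
  rw [mul_pow, mul_mul_mul_comm, ← sq, sq (inner ℝ _ _)]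
  exact mul_le_mul_of_nonneg_left (real_inner_mul_inner_self_le _ _) (sq_nonneg _)

theorem abs_sum_integral_glue_mul_div_le_normV (p : Fin n → ScalarField d)
    (hz : ∀ i, MemHDiv Ω (T.glueV (z i))) :
    |∑ i, ∫ x in Ω, T.glue (p i) x * T.div (z i) x| ≤ T.normP M p * T.normV M z := by
  have hdiv (i : Fin n) := memLp_div (hz i)
  rw [← integral_finsetSum _ fun i _ => T.integrable_glue_mul (p i) (hdiv i)]
  calc |∫ x in Ω, ∑ i, T.glue (p i) x * T.div (z i) x|
      ≤ T.normP M p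
        * √(∫ x in Ω, (M.Lambda⁻¹ *ᵥ fun i => T.div (z i) x) ⬝ᵥ fun i => T.div (z i) x) :=
        abs_integral_le_sqrt_mul_sqrt (T.integrable_Lambda_mulVec_dotProduct p)
          (integrable_mulVec_dotProduct M.Lambda⁻¹ hdiv hdiv)
          (fun x => mulVec_dotProduct_self_nonneg M.posDef_Lambda.posSemidef _)
          (fun x => mulVec_dotProduct_self_nonneg M.posDef_Lambda.inv.posSemidef _)
          fun x => dotProduct_sq_le_mul_inv M.posDef_Lambda _ _
    _ ≤ T.normP M p * T.normV M z :=
        mul_le_mul_of_nonneg_left (T.sqrt_integral_Lambda_inv_div_le_normV z) (T.normP_nonneg M p)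

theorem abs_pressure_term_le (p q : Fin n → ScalarField d) :
    |(∑ i, (-M.alphaP i - M.alphaNet i i) * ∫ x in Ω, T.glue (p i) x * T.glue (q i) x)
      + ∑ i, ∑ j ∈ Finset.univ.erase i,
        M.alphaNet i j * ∫ x in Ω, T.glue (p j) x * T.glue (q i) x|
      ≤ T.normP M p * T.normP M q := by
  have h12 := M.posSemidef_Lambda1.add M.posSemidef_Lambda2
  have Lambda_nonneg (x : Fin n → ℝ) : 0 ≤ M.Lambda *ᵥ x ⬝ᵥ x :=
    mulVec_dotProduct_self_nonneg M.posDef_Lambda.posSemidef x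
  rw [T.pressure_term_eq, abs_neg]
  exact abs_integral_le_sqrt_mul_sqrt (T.integrable_Lambda_mulVec_dotProduct p)
    (T.integrable_Lambda_mulVec_dotProduct q) (fun x => Lambda_nonneg _) (fun x => Lambda_nonneg _)
    fun x => (mulVec_dotProduct_sq_le h12 _ _).trans
      (mul_le_mul (M.Lambda1_add_Lambda2_mulVec_dotProduct_le _)
        (M.Lambda1_add_Lambda2_mulVec_dotProduct_le _) (mulVec_dotProduct_self_nonneg h12 _)
        (Lambda_nonneg _))

theorem abs_Ah_le (η : ℝ) (hu : MemHDiv Ω (T.glueV u)) (hw : MemHDiv Ω (T.glueV w))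
    (hv : ∀ i, MemHDiv Ω (T.glueV (v i))) (hz : ∀ i, MemHDiv Ω (T.glueV (z i)))
    (p q : Fin n → ScalarField d) :
    |T.Ah M η u v p w z q| ≤ |T.ah η u w| + T.normU M u * T.normU M w
      + √(d + 1) * (T.normP M p * T.normU M w) + T.normV M v * T.normV M z
      + T.normP M p * T.normV M z + √(d + 1) * (T.normP M q * T.normU M u)
      + T.normP M q * T.normV M v + T.normP M p * T.normP M q := by
  have elasticity := abs_le.1 (le_refl |T.ah η u w|)
  have divergence := abs_le.1 (T.abs_lam_mul_integral_div_mul_div_le (M := M) hu hw)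
  have pressure_divergence := abs_le.1 (T.abs_sum_integral_glue_mul_div_le_normU (M := M) p hw)
  have flux := abs_le.1 (T.abs_sum_integral_flux_le (M := M) hv hz)
  have pressure_flux := abs_le.1 (T.abs_sum_integral_glue_mul_div_le_normV (M := M) p hz)
  have divergence_pressure := abs_le.1 (T.abs_sum_integral_glue_mul_div_le_normU (M := M) q hu)
  have flux_pressure := abs_le.1 (T.abs_sum_integral_glue_mul_div_le_normV (M := M) q hv)
  have pressure := abs_le.1 (T.abs_pressure_term_le (M := M) p q)
  simp only [mul_comm (T.glue (q _) _)] at divergence_pressure flux_pressure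
  rw [Ah, abs_le]
  constructor <;> linarith

end Triangulation

theorem Family.IsLocal.totalDegree_le {F : Family} {l : ℕ} {K : Finset (Pt d)}
    {u : Fin d → MvPolynomial (Fin d) ℝ} (h : F.IsLocal l K u) (i : Fin d) :
    (u i).totalDegree ≤ l := by
  cases F
  · exact h i
  · exact h.1 i

theorem Triangulation.degreeLE_of_mem_Uh {Ω : Set (Pt d)} {T : Triangulation d Ω} {F : Family}
    {l : ℕ} {u : VectorField d} (hu : u ∈ T.Uh F l) : T.DegreeLE l u :=
  fun K hK => (hu.2.1 K hK).totalDegree_le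

theorem coupling_sum_le {a b c a' b' c' C D : ℝ} (ha : 0 ≤ a) (hb : 0 ≤ b) (hc : 0 ≤ c)
    (ha' : 0 ≤ a') (hb' : 0 ≤ b') (hc' : 0 ≤ c') (hC : 0 ≤ C) (hD : 0 ≤ D) :
    C * (a * a') + a * a' + D * (c * a') + b * b' + c * b' + D * (c' * a) + c' * b + c * c'
      ≤ (C + D + 1) * (a + b + c) * (a' + b' + c') := by
  rw [← sub_nonneg]
  ring_nf
  positivity

end MPET

theorem theorem4p1_general {d : ℕ} (hd : 2 ≤ d) (l : ℕ) (σ η : ℝ) :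
    ∃ C : ℝ, 0 < C ∧
      ∀ (Ω : Set (Pt d)) (T : Triangulation d Ω), T.ShapeRegular σ →
      ∀ (n : ℕ) [NeZero n] (M : Params n)
        (u w : VectorField d) (v z : Fin n → VectorField d) (p q : Fin n → ScalarField d),
        MemHDiv Ω (T.glueV u) → MemHDiv Ω (T.glueV w) → T.DegreeLE l u → T.DegreeLE l w →
        (∀ i, MemHDiv Ω (T.glueV (v i))) → (∀ i, MemHDiv Ω (T.glueV (z i))) →
        |T.Ah M η u v p w z q| ≤
          C * (T.normU M u + T.normV M v + T.normP M p)
            * (T.normU M w + T.normV M z + T.normP M q) := by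
  obtain ⟨C, hC, abs_ah_le⟩ := Triangulation.exists_abs_ah_le hd l σ η
  refine ⟨C + √(d + 1) + 1, by positivity, ?_⟩
  intro Ω T hT n _ M u w v z p q hu hw hul hwl hv hz
  have elasticity : |T.ah η u w| ≤ C * (T.normU M u * T.normU M w) :=
    (abs_ah_le Ω T hT u w hul hwl).trans (mul_le_mul_of_nonneg_left
      (mul_le_mul (T.sqrt_dgNormSq_le_normU M u) (T.sqrt_dgNormSq_le_normU M w)
        (Real.sqrt_nonneg _) (T.normU_nonneg M u)) hC)
  have couplings := coupling_sum_le (T.normU_nonneg M u) (T.normV_nonneg M v) (T.normP_nonneg M p)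
    (T.normU_nonneg M w) (T.normV_nonneg M z) (T.normP_nonneg M q) hC (Real.sqrt_nonneg (d + 1))
  linarith [T.abs_Ah_le (M := M) η hu hw hv hz p q]

/-- Uniform boundedness of the discrete bilinear form: the constant `C` may depend on the dimension,
the domain, the degree and the family of the elements, the shape regularity constant `σ` and the
stabilization parameter `η`, but neither on the triangulation (hence not on its mesh size) nor on
the number of networks nor on any model parameter. -/
theorem theorem4p1 (d : ℕ) (hd : d = 2 ∨ d = 3) (Ω : Set (Pt d)) (F : Family) (l : ℕ) (hl : 1 ≤ l)
    (σ η : ℝ) (hη : 0 < η) :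
    ∃ C : ℝ, 0 < C ∧
      ∀ T : Triangulation d Ω, T.ShapeRegular σ →
      ∀ (n : ℕ) [NeZero n] (M : Params n)
        (u w : VectorField d) (v z : Fin n → VectorField d) (p q : Fin n → ScalarField d),
        u ∈ T.Uh F l → w ∈ T.Uh F l →
        (∀ i, v i ∈ T.Vh l) → (∀ i, z i ∈ T.Vh l) →
        (∀ i, p i ∈ T.Ph l) → (∀ i, q i ∈ T.Ph l) →
        |T.Ah M η u v p w z q| ≤
          C * (T.normU M u + T.normV M v + T.normP M p)
            * (T.normU M w + T.normV M z + T.normP M q) := by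
  obtain ⟨C, hC, abs_Ah_le⟩ := theorem4p1_general (d := d) (by omega) l σ η
  exact ⟨C, hC, fun T hT n _ M u w v z p q hu hw hv hz _ _ =>
    abs_Ah_le Ω T hT n M u w v z p q hu.1 hw.1 (Triangulation.degreeLE_of_mem_Uh hu)
      (Triangulation.degreeLE_of_mem_Uh hw) (fun i => (hv i).1) fun i => (hz i).1⟩
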